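/- Let $M\subset\mathbb R^3$ be a compact embedded $C^\infty$ surface with (possibly empty) boundary $\partial M$, oriented by a continuous unit normal field $N$; let $dA$ be its area element, $X$ the position vector, and give $\partial M$ the induced orientation (its positive unit tangent $T$ is such that $N\times T$ points into $M$). For every point of $M$ let $P,Q$ be orthonormal principal directions with principal curvatures $\kappa_1,\kappa_2$, that is, tangent vectors with $dN(P)=-\kappa_1P$ and $dN(Q)=-\kappa_2Q$, oriented so that $P\times Q=N$; the fields $P,Q$ are not required to be continuous. Write $\int_{\partial M}V\cdot dW=\int_{\partial M}V\cdot W_s\,ds$, where $s$ is arc length along the oriented boundary and $W_s$ is the derivative of $W$ with respect to $s$. Then for every $C^2$ function $F:\mathbb R^3\to\mathbb R$ all the integrands below are integrable, and $$\int_{\partial M}\nabla F(X)\cdot dN=-\int_M(\kappa_2-\kappa_1)\,\big(\nabla^2F(X)\,P\big)\cdot Q\,dA,$$ $$\int_{\partial M}\nabla F(N)\cdot dX=\int_M(\kappa_2-\kappa_1)\,\big(\nabla^2F(N)\,P\big)\cdot Q\,dA.$$ -/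

import Mathlib

open MeasureTheory
open scoped ContDiff InnerProductSpace

noncomputable section

/-- Euclidean three-space. -/
abbrev Euc3 : Type := EuclideanSpace ℝ (Fin 3)

/-- The cross product of two vectors of Euclidean three-space. -/
def cross3 (u v : Euc3) : Euc3 := WithLp.toLp 2 (crossProduct u.ofLp v.ofLp)

/-- `Φ` is a smooth diffeomorphism from an open neighbourhood of `p` onto an open set, which carries
`M` to the part of the closed half-plane `{x₂ = 0, x₀ ≥ 0}` in the target of `Φ`.
(Near an interior point of `M` the target can be taken inside `{x₀ > 0}`.) -/
structure IsFlatteningChart (M : Set Euc3) (p : Euc3) (Φ : OpenPartialHomeomorph Euc3 Euc3) :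
    Prop where
  mem_source : p ∈ Φ.source
  smooth : ContDiffOn ℝ ∞ Φ Φ.source
  smooth_symm : ContDiffOn ℝ ∞ Φ.symm Φ.target
  mem_iff : ∀ x ∈ Φ.source, x ∈ M ↔ Φ x 2 = 0 ∧ 0 ≤ Φ x 0

/-- `M` is a compact embedded `C^∞` surface with (possibly empty) boundary in three-space. -/
structure IsCompactSurface (M : Set Euc3) : Prop where
  compact : IsCompact M
  exists_chart : ∀ p ∈ M, ∃ Φ, IsFlatteningChart M p Φ

/-- The boundary `∂M`: the points that some flattening chart sends to the edge of the half-plane. -/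
def surfaceBoundary (M : Set Euc3) : Set Euc3 :=
  {p | p ∈ M ∧ ∃ Φ, IsFlatteningChart M p Φ ∧ Φ p 0 = 0}

/-- `N` is a continuous field of unit normals on `M`, that is, an orientation of `M`. -/
structure IsUnitNormal (M : Set Euc3) (N : Euc3 → Euc3) : Prop where
  continuousOn : ContinuousOn N M
  norm_eq_one : ∀ p ∈ M, ‖N p‖ = 1
  inner_eq_zero : ∀ p ∈ M, ∀ v ∈ posTangentConeAt M p, ⟪N p, v⟫_ℝ = 0

/-- `P`, `Q` are orthonormal principal directions of `M` with `P × Q = N` (so that both are tangent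
to `M`) and with principal curvatures `κ₁`, `κ₂`; they need not be continuous.
The derivative of `N` within `M`, on tangent vectors, is the differential of the Gauss map. -/
structure IsPrincipalFrame (M : Set Euc3) (N P Q : Euc3 → Euc3) (κ₁ κ₂ : Euc3 → ℝ) : Prop where
  norm_left : ∀ p ∈ M, ‖P p‖ = 1
  norm_right : ∀ p ∈ M, ‖Q p‖ = 1
  orthogonal : ∀ p ∈ M, ⟪P p, Q p⟫_ℝ = 0
  cross_eq : ∀ p ∈ M, cross3 (P p) (Q p) = N p
  deriv_left : ∀ p ∈ M, fderivWithin ℝ N M p (P p) = -(κ₁ p • P p)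
  deriv_right : ∀ p ∈ M, fderivWithin ℝ N M p (Q p) = -(κ₂ p • Q p)

/-- `T` is the unit tangent to `∂M` at `p` for the boundary orientation: `N × T` points into `M`. -/
structure IsPositiveBoundaryTangent (M : Set Euc3) (N : Euc3 → Euc3) (p T : Euc3) : Prop where
  norm_eq_one : ‖T‖ = 1
  tangent : T ∈ posTangentConeAt (surfaceBoundary M) p
  inward : cross3 (N p) T ∈ posTangentConeAt M p

open Classical in
/-- The positively oriented unit tangent field of `∂M` (at a boundary point of an oriented surface
there is exactly one such vector). -/
def boundaryTangent (M : Set Euc3) (N : Euc3 → Euc3) (p : Euc3) : Euc3 :=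
  if h : ∃ T, IsPositiveBoundaryTangent M N p T then h.choose else 0

/-- The density of `V · dW` with respect to arc length along the oriented curve `∂M`: the inner
product of `V` with the derivative of `W` along the unit tangent. -/
def boundaryDensity (M : Set Euc3) (N V W : Euc3 → Euc3) (p : Euc3) : ℝ :=
  ⟪V p, fderivWithin ℝ W (surfaceBoundary M) p (boundaryTangent M N p)⟫_ℝ

/-- The line integral `∫_{∂M} V · dW`; arc length is one-dimensional Hausdorff measure. -/
def boundaryIntegral (M : Set Euc3) (N V W : Euc3 → Euc3) : ℝ :=
  ∫ p in surfaceBoundary M, boundaryDensity M N V W p ∂μHE[1]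

/-- The Hessian of `F` at `x`, as a linear map: the derivative of the gradient. -/
def hessian3 (F : Euc3 → ℝ) (x : Euc3) : Euc3 →L[ℝ] Euc3 := fderiv ℝ (gradient F) x

end

/-!
Both identities are Stokes' theorem on `M` for a one-form `⟪V, dW⟫ = ∑ Vᵢ dWᵢ`, where `V` and `W` are
vector fields of three-space. Its differential `∑ dVᵢ ∧ dWᵢ` takes the value
`⟪dV(P), dW(Q)⟫ - ⟪dV(Q), dW(P)⟫` on the frame `P, Q`. As `dN(P) = -κ₁ P` and `dN(Q) = -κ₂ Q`, and as
the Hessian is symmetric, this is `-(κ₂ - κ₁) ⟪∇²F(X) P, Q⟫` for `V = ∇F`, `W = N`, and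
`(κ₂ - κ₁) ⟪∇²F(N) P, Q⟫` for `V = ∇F ∘ N`, `W = id`. To have fields of three-space, `N` is replaced by
a smooth extension (`IsCompactSurface.exists_contDiff_eq_normal`), which has the same derivative on
tangent vectors (`IsCompactSurface.fderivWithin_eq_of_inner_eq_zero`).

Stokes' theorem (`IsCompactSurface.stokes`) is reduced by a partition of unity to a field `V` supported
in one chart. There, the area and length integrals become Lebesgue integrals over a rectangle and
over one of its sides, and the theorem becomes Green's formula
(`integral_inner_fderiv_wedge_eq_neg_integral_left`). The passage to coordinates has two ingredients.

* The area formula: for an injective `C¹` immersion `f` of a Euclidean space, the Euclidean Hausdorff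
  measure on the image is the push-forward of Lebesgue measure weighted by the norm determinant of
  `fderiv ℝ f` (`euclideanHausdorffMeasure_image_eq_lintegral_normDet`). Near a point, `f` distorts
  distances by a factor close to one relative to its derivative, and for linear maps the formula is
  known; a countable partition gives both inequalities up to an arbitrary factor `c > 1`.
* The determination of tangent cones in a flattening chart with coordinate fields `a, b, c`: the cone
  of `M` is spanned by `a` and `b`, or is the half-plane of nonnegative `a`-component at the boundary,
  and the cone of `∂M` is the line of `b`. Hence the boundary does not depend on the chart
  (`IsFlatteningChart.mem_surfaceBoundary_iff`), `N` is `± a × b / ‖a × b‖`, and the boundary tangent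
  is `∓ b / ‖b‖` with the opposite sign (`IsFlatteningChart.boundaryTangent_eq`). The sign cancels in
  Stokes' theorem.

The surface integrand depends on `P, Q` only through `P × Q = N` (`inner_wedgeVector_cross3`), so it is
continuous although `P` and `Q` need not be.
-/

open Set Filter Topology Module
open scoped NNReal ENNReal

/-! ### The area formula for Euclidean Hausdorff measure -/

/-- If `f` stretches distances at most `t` times as much as `g` does, then the image of a set under
`f` is at most `t ^ d` times as large as its image under `g`. -/
theorem euclideanHausdorffMeasure_image_le_of_edist_le {X Y Z : Type*}
    [EMetricSpace Y] [MeasurableSpace Y] [BorelSpace Y]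
    [EMetricSpace Z] [MeasurableSpace Z] [BorelSpace Z]
    (d : ℕ) (f : X → Y) (g : X → Z) (A : Set X) (t : ℝ≥0)
    (h : ∀ x ∈ A, ∀ y ∈ A, edist (f x) (f y) ≤ t * edist (g x) (g y)) :
    μHE[d] (f '' A) ≤ (t : ℝ≥0∞) ^ d * μHE[d] (g '' A) := by
  classical
  rcases A.eq_empty_or_nonempty with rfl | ⟨x₀, hx₀⟩
  · simp
  have : Nonempty X := ⟨x₀⟩
  set r := Function.invFunOn g A with hr
  have hrA : ∀ x ∈ A, r (g x) ∈ A := fun x hx => Function.invFunOn_mem ⟨x, hx, rfl⟩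
  have hrg : ∀ x ∈ A, g (r (g x)) = g x := fun x hx => Function.invFunOn_eq ⟨x, hx, rfl⟩
  have himg : f '' A = (f ∘ r) '' (g '' A) := by
    rw [image_image]
    refine image_congr fun x hx => ?_
    have := h x hx _ (hrA x hx)
    rw [hrg x hx, edist_self, mul_zero, nonpos_iff_eq_zero, edist_eq_zero] at this
    exact this
  have hlip : LipschitzOnWith t (f ∘ r) (g '' A) := by
    rintro _ ⟨x, hx, rfl⟩ _ ⟨y, hy, rfl⟩
    simpa [hrg x hx, hrg y hy] using h _ (hrA x hx) _ (hrA y hy)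
  rw [himg]
  have key := hlip.hausdorffMeasure_image_le (d := d) (Nat.cast_nonneg d)
  rw [ENNReal.rpow_natCast] at key
  simp_rw [Measure.euclideanHausdorffMeasure_def, Measure.smul_apply, ENNReal.smul_def,
    smul_eq_mul]
  calc _ ≤ _ * ((t : ℝ≥0∞) ^ d * μH[d] (g '' A)) := by gcongr
    _ = _ := by ring

theorem ENNReal.le_of_forall_one_lt_le_coe_mul {a b : ℝ≥0∞}
    (h : ∀ c : ℝ≥0, 1 < c → a ≤ c * b) : a ≤ b := by
  have h1 : Tendsto (fun c : ℝ≥0 => (c : ℝ≥0∞) * b) (𝓝[>] 1) (𝓝 ((1 : ℝ≥0) * b)) :=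
    ENNReal.Tendsto.mul_const
      ((ENNReal.continuous_coe.tendsto 1).mono_left nhdsWithin_le_nhds) (Or.inl (by simp))
  rw [ENNReal.coe_one, one_mul] at h1
  exact ge_of_tendsto h1 (eventually_nhdsWithin_of_forall h)

theorem LinearMap.continuous_normDet {E F : Type*} [NormedAddCommGroup E] [InnerProductSpace ℝ E]
    [FiniteDimensional ℝ E] [NormedAddCommGroup F] [InnerProductSpace ℝ F] :
    Continuous fun f : E →L[ℝ] F => (f : E →ₗ[ℝ] F).normDet := by
  have h : (fun f : E →L[ℝ] F => (f : E →ₗ[ℝ] F).normDet) = fun f : E →L[ℝ] F =>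
      √(Matrix.gram ℝ (fun i => f (stdOrthonormalBasis ℝ E i))).det := by
    funext f
    have := LinearMap.normDet_sq_eq_det_gram (f : E →ₗ[ℝ] F) (stdOrthonormalBasis ℝ E)
    rw [RCLike.ofReal_real_eq_id] at this
    rw [← Real.sqrt_sq (LinearMap.normDet_nonneg _)]
    exact congrArg Real.sqrt this
  rw [h]
  refine Real.continuous_sqrt.comp (Continuous.matrix_det ?_)
  refine continuous_matrix fun i j => ?_
  simp only [Matrix.gram_apply]
  fun_prop

theorem aemeasurable_normDet_fderiv {E F : Type*} [NormedAddCommGroup E] [InnerProductSpace ℝ E]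
    [FiniteDimensional ℝ E] [MeasurableSpace E] [BorelSpace E] [NormedAddCommGroup F]
    [InnerProductSpace ℝ F] {f : E → F} {S : Set E} (hf : ∀ x ∈ S, ContDiffAt ℝ 1 f x) (hS : MeasurableSet S) :
    AEMeasurable (fun x => (fderiv ℝ f x : E →ₗ[ℝ] F).normDet.toNNReal)
      ((volume : Measure E).restrict S) := by
  refine AEMeasurable.real_toNNReal (ContinuousOn.aemeasurable (fun x hx => ?_) hS)
  exact (LinearMap.continuous_normDet.continuousAt.comp
    ((hf x hx).continuousAt_fderiv one_ne_zero)).continuousWithinAt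

section AreaFormula

variable {E F : Type*} [NormedAddCommGroup E] [InnerProductSpace ℝ E] [FiniteDimensional ℝ E]
  [MeasurableSpace E] [BorelSpace E] [NormedAddCommGroup F] [InnerProductSpace ℝ F]
  [MeasurableSpace F] [BorelSpace F]

/-- Near a point where its derivative `f'` is injective, `f` distorts distances almost exactly as
`f'` does, hence multiplies the measure of small sets almost exactly by the norm determinant. -/
theorem HasStrictFDerivAt.exists_nhds_euclideanHausdorffMeasure_image {f : E → F} {f' : E →L[ℝ] F}
    {x : E} (hf : HasStrictFDerivAt f f' x) (hf' : (f' : E →ₗ[ℝ] F).ker = ⊥) {c : ℝ≥0}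
    (hc : 1 < c) :
    ∃ O ∈ 𝓝 x, ∀ A ⊆ O,
      μHE[finrank ℝ E] (f '' A)
        ≤ c * (ENNReal.ofReal (f' : E →ₗ[ℝ] F).normDet * volume A) ∧
      ENNReal.ofReal (f' : E →ₗ[ℝ] F).normDet * volume A
        ≤ c * μHE[finrank ℝ E] (f '' A) := by
  obtain ⟨t, ht1, htc⟩ : ∃ t : ℝ≥0, 1 < t ∧ t ^ finrank ℝ E ≤ c := by
    have h1 : Tendsto (fun t : ℝ≥0 => t ^ finrank ℝ E) (𝓝[>] 1) (𝓝 (1 ^ finrank ℝ E)) :=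
      ((continuous_pow _).tendsto 1).mono_left nhdsWithin_le_nhds
    rw [one_pow] at h1
    obtain ⟨t, h2, h3⟩ :=
      ((h1.eventually_le_const hc).and
        self_mem_nhdsWithin).exists
    exact ⟨t, h3, h2⟩
  obtain ⟨K, hK, hKf⟩ := LinearMap.exists_antilipschitzWith (f' : E →ₗ[ℝ] F) hf'
  have ht0 : (0 : ℝ) < t := by exact_mod_cast zero_lt_one.trans ht1
  have ht1' : (1 : ℝ) < t := by exact_mod_cast ht1
  -- With this `δ`, both `1 + δ ≤ t` and `1 - δ = 1 / t` hold.
  set δ : ℝ := 1 - 1 / t with hδ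
  have hδ0 : 0 < δ := by rw [hδ, sub_pos, div_lt_one ht0]; exact ht1'
  have hδt : 1 + δ ≤ t := by
    rw [hδ]
    have : 0 ≤ (t - 1 : ℝ) ^ 2 / t := by positivity
    have h2 : (t - 1 : ℝ) ^ 2 / t = t - 2 + 1 / t := by field_simp; ring
    linarith
  obtain ⟨O, hO, hap⟩ := hf.approximates_deriv_on_nhds (c := δ.toNNReal / K)
    (Or.inr (div_pos (Real.toNNReal_pos.2 hδ0) hK))
  have hmain : ∀ y ∈ O, ∀ z ∈ O, ‖f y - f z - f' (y - z)‖ ≤ δ * ‖f' (y - z)‖ := by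
    intro y hy z hz
    have h1 := hap y hy z hz
    have h2 : ‖y - z‖ ≤ K * ‖f' (y - z)‖ := by
      have := hKf.le_mul_dist y z
      simpa [dist_eq_norm] using this
    have hK' : (0 : ℝ) < K := hK
    calc _ ≤ δ / K * ‖y - z‖ := by simpa [Real.coe_toNNReal δ hδ0.le] using h1
      _ ≤ δ / K * (K * ‖f' (y - z)‖) := by gcongr
      _ = _ := by field_simp
  refine ⟨O, hO, fun A hA => ?_⟩
  have htc' : (t : ℝ≥0∞) ^ finrank ℝ E ≤ c := by exact_mod_cast htc
  rw [← LinearMap.euclideanHausdorffMeasure_image_eq_normDet_mul_volume]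
  constructor
  · refine (euclideanHausdorffMeasure_image_le_of_edist_le _ f f' A t fun y hy z hz => ?_).trans
      (by gcongr; rfl)
    have := hmain y (hA hy) z (hA hz)
    rw [edist_nndist, edist_nndist, ← ENNReal.coe_mul, ENNReal.coe_le_coe, ← NNReal.coe_le_coe]
    simp only [NNReal.coe_mul, coe_nndist, dist_eq_norm, ← map_sub]
    calc ‖f y - f z‖ = ‖(f y - f z - f' (y - z)) + f' (y - z)‖ := by simp
      _ ≤ δ * ‖f' (y - z)‖ + ‖f' (y - z)‖ := (norm_add_le _ _).trans (by gcongr)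
      _ = (1 + δ) * ‖f' (y - z)‖ := by ring
      _ ≤ _ := by gcongr
  · refine (euclideanHausdorffMeasure_image_le_of_edist_le _ f' f A t fun y hy z hz => ?_).trans
      (by gcongr)
    have := hmain y (hA hy) z (hA hz)
    rw [edist_nndist, edist_nndist, ← ENNReal.coe_mul, ENNReal.coe_le_coe, ← NNReal.coe_le_coe]
    simp only [NNReal.coe_mul, coe_nndist, dist_eq_norm, ← map_sub]
    have h3 : ‖f' (y - z)‖ ≤ ‖f y - f z‖ + δ * ‖f' (y - z)‖ := by
      calc ‖f' (y - z)‖ = ‖(f y - f z) - (f y - f z - f' (y - z))‖ := by simp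
        _ ≤ _ := (norm_sub_le _ _).trans (by gcongr)
    have h4 : 1 / t * ‖f' (y - z)‖ ≤ ‖f y - f z‖ := by rw [hδ] at h3; linarith
    calc ‖f' (y - z)‖ = t * (1 / t * ‖f' (y - z)‖) := by field_simp
      _ ≤ _ := by gcongr

variable {f : E → F} {S : Set E}

/-- The area formula for the measure of the image of a set under an injective `C¹` immersion. -/
theorem euclideanHausdorffMeasure_image_eq_lintegral_normDet
    (hf : ∀ x ∈ S, ContDiffAt ℝ 1 f x)
    (hker : ∀ x ∈ S, (fderiv ℝ f x : E →ₗ[ℝ] F).ker = ⊥) (hinj : InjOn f S)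
    (hS : MeasurableSet S) :
    μHE[finrank ℝ E] (f '' S)
      = ∫⁻ x in S, ENNReal.ofReal (fderiv ℝ f x : E →ₗ[ℝ] F).normDet := by
  have hcont : ContinuousOn f S := fun x hx => (hf x hx).continuousAt.continuousWithinAt
  set J : E → ℝ := fun x => (fderiv ℝ f x : E →ₗ[ℝ] F).normDet with hJ
  -- Both sides agree up to any factor `c > 1` on small pieces of `S`, hence on `S`.
  have key : ∀ c : ℝ≥0, 1 < c →
      μHE[finrank ℝ E] (f '' S) ≤ c * ∫⁻ x in S, ENNReal.ofReal (J x) ∧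
      ∫⁻ x in S, ENNReal.ofReal (J x) ≤ c * μHE[finrank ℝ E] (f '' S) := by
    intro c hc
    obtain ⟨t, ht1, htc⟩ : ∃ t : ℝ≥0, 1 < t ∧ t * t ≤ c := by
      refine ⟨NNReal.sqrt c, ?_, (NNReal.mul_self_sqrt c).le⟩
      rw [← NNReal.sqrt_one]; exact NNReal.sqrt_lt_sqrt.2 hc
    have ht1' : (1 : ℝ) < t := by exact_mod_cast ht1
    have htc' : (t : ℝ≥0∞) * t ≤ c := by exact_mod_cast htc
    have hloc : ∀ x ∈ S, ∃ O : Set E, IsOpen O ∧ x ∈ O ∧ ∀ A ⊆ O, MeasurableSet A →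
        μHE[finrank ℝ E] (f '' A) ≤ c * ∫⁻ x in A, ENNReal.ofReal (J x) ∧
        ∫⁻ x in A, ENNReal.ofReal (J x) ≤ c * μHE[finrank ℝ E] (f '' A) := by
      intro x hx
      obtain ⟨O, hO, hOA⟩ :=
        ((hf x hx).hasStrictFDerivAt one_ne_zero).exists_nhds_euclideanHausdorffMeasure_image
          (hker x hx) ht1
      have hJpos : 0 < J x := by
        refine lt_of_le_of_ne (LinearMap.normDet_nonneg _) (Ne.symm fun h0 => ?_)
        exact (LinearMap.normDet_eq_zero_iff_ker_ne_bot.1 h0) (hker x hx)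
      have hJc : ContinuousAt J x :=
        LinearMap.continuous_normDet.continuousAt.comp ((hf x hx).continuousAt_fderiv one_ne_zero)
      have h1 : ∀ᶠ y in 𝓝 x, J y < t * J x :=
        hJc.eventually_lt continuousAt_const (by nlinarith)
      have h2 : ∀ᶠ y in 𝓝 x, J x < t * J y :=
        continuousAt_const.eventually_lt (continuousAt_const.mul hJc) (by nlinarith)
      obtain ⟨O', hO's, hO', hxO'⟩ := mem_nhds_iff.1 (Filter.inter_mem hO (h1.and h2))
      refine ⟨O', hO', hxO', fun A hA hAm => ?_⟩
      obtain ⟨ha, hb⟩ := hOA A fun y hy => (hO's (hA hy)).1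
      have hup : ∫⁻ x in A, ENNReal.ofReal (J x) ≤ t * (ENNReal.ofReal (J x) * volume A) := by
        rw [← mul_assoc, ← setLIntegral_const]
        refine setLIntegral_mono measurable_const fun y hy => ?_
        rw [← ENNReal.ofReal_coe_nnreal, ← ENNReal.ofReal_mul t.coe_nonneg]
        exact ENNReal.ofReal_le_ofReal (hO's (hA hy)).2.1.le
      have hlo : ENNReal.ofReal (J x) * volume A ≤ t * ∫⁻ x in A, ENNReal.ofReal (J x) := by
        rw [← setLIntegral_const, ← lintegral_const_mul' _ _ ENNReal.coe_ne_top]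
        refine setLIntegral_mono' hAm fun y hy => ?_
        rw [← ENNReal.ofReal_coe_nnreal, ← ENNReal.ofReal_mul t.coe_nonneg]
        exact ENNReal.ofReal_le_ofReal (hO's (hA hy)).2.2.le
      constructor
      · calc _ ≤ _ := ha
          _ ≤ t * (t * ∫⁻ x in A, ENNReal.ofReal (J x)) := by gcongr
          _ ≤ _ := by rw [← mul_assoc]; gcongr
      · calc _ ≤ _ := hup
          _ ≤ t * (t * μHE[finrank ℝ E] (f '' A)) := by gcongr
          _ ≤ _ := by rw [← mul_assoc]; gcongr
    choose! O hOo hxO hOA using hloc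
    obtain ⟨T, hTS, hTc, hST⟩ := TopologicalSpace.countable_cover_nhdsWithin
      (fun x hx => mem_nhdsWithin_of_mem_nhds ((hOo x hx).mem_nhds (hxO x hx)))
    rcases S.eq_empty_or_nonempty with rfl | hSne
    · simp
    have hTne : T.Nonempty := by
      obtain ⟨x, hx⟩ := hSne
      obtain ⟨y, hy, -⟩ := mem_iUnion₂.1 (hST hx)
      exact ⟨y, hy⟩
    obtain ⟨u, rfl⟩ := hTc.exists_eq_range hTne
    set A : ℕ → Set E := fun n => S ∩ disjointed (fun n => O (u n)) n with hAdef
    have hAm : ∀ n, MeasurableSet (A n) := fun n =>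
      hS.inter (MeasurableSet.disjointed (fun i => (hOo _ (hTS ⟨i, rfl⟩)).measurableSet) n)
    have hAd : Pairwise (Function.onFun Disjoint A) := fun i j hij =>
      (disjoint_disjointed _ hij).mono inter_subset_right inter_subset_right
    have hAU : ⋃ n, A n = S := by
      rw [← inter_iUnion, iUnion_disjointed]
      refine inter_eq_left.2 (hST.trans ?_)
      simp
    have hAO : ∀ n, A n ⊆ O (u n) := fun n => inter_subset_right.trans (disjointed_subset _ n)
    have hAS : ∀ n, A n ⊆ S := fun n => inter_subset_left
    have hμ : μHE[finrank ℝ E] (f '' S) = ∑' n, μHE[finrank ℝ E] (f '' A n) := by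
      rw [← hAU, image_iUnion, measure_iUnion]
      · intro i j hij
        exact (hAd hij).image hinj (hAS i) (hAS j)
      · exact fun n => (hAm n).image_of_continuousOn_injOn (hcont.mono (hAS n)) (hinj.mono (hAS n))
    have hν : ∫⁻ x in S, ENNReal.ofReal (J x) = ∑' n, ∫⁻ x in A n, ENNReal.ofReal (J x) := by
      conv_lhs => rw [← hAU]
      exact lintegral_iUnion hAm hAd _
    rw [hμ, hν, ← ENNReal.tsum_mul_left, ← ENNReal.tsum_mul_left]
    exact ⟨ENNReal.tsum_le_tsum fun n => (hOA _ (hTS ⟨n, rfl⟩) _ (hAO n) (hAm n)).1,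
      ENNReal.tsum_le_tsum fun n => (hOA _ (hTS ⟨n, rfl⟩) _ (hAO n) (hAm n)).2⟩
  exact le_antisymm (ENNReal.le_of_forall_one_lt_le_coe_mul fun c hc => (key c hc).1)
    (ENNReal.le_of_forall_one_lt_le_coe_mul fun c hc => (key c hc).2)

/-- The Euclidean Hausdorff measure on the image of an injective immersion is the image of the
Lebesgue measure weighted by the norm determinant of the derivative. -/
theorem map_comap_withDensity_normDet_eq_euclideanHausdorffMeasure
    (hf : ∀ x ∈ S, ContDiffAt ℝ 1 f x)
    (hker : ∀ x ∈ S, (fderiv ℝ f x : E →ₗ[ℝ] F).ker = ⊥) (hinj : InjOn f S)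
    (hS : MeasurableSet S) :
    Measure.map (S.domRestrict f) (Measure.comap (↑) ((volume : Measure E).withDensity
      fun x => ENNReal.ofReal (fderiv ℝ f x : E →ₗ[ℝ] F).normDet))
      = (μHE[finrank ℝ E]).restrict (f '' S) := by
  have hcont : ContinuousOn f S := fun x hx => (hf x hx).continuousAt.continuousWithinAt
  have hemb := hcont.measurableEmbedding hS hinj
  ext t ht
  have hm : MeasurableSet (S.domRestrict f ⁻¹' t) := hemb.measurable ht
  have hm' : MeasurableSet (S ∩ f ⁻¹' t) := by
    have := hS.subtype_image hm
    convert this using 1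
    ext x
    simp [and_comm]
  have himg : ((↑) '' (S.domRestrict f ⁻¹' t) : Set E) = S ∩ f ⁻¹' t := by ext x; simp [and_comm]
  rw [Measure.map_apply hemb.measurable ht, comap_subtype_coe_apply hS, himg,
    withDensity_apply _ hm', Measure.restrict_apply ht,
    ← euclideanHausdorffMeasure_image_eq_lintegral_normDet
      (fun x hx => hf x hx.1) (fun x hx => hker x hx.1) (hinj.mono inter_subset_left) hm',
    image_inter_preimage, inter_comm]

/-- Integrability in the area formula. -/
theorem integrableOn_image_iff_integrableOn_normDet_smul
    {G : Type*} [NormedAddCommGroup G]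
    [NormedSpace ℝ G] (hf : ∀ x ∈ S, ContDiffAt ℝ 1 f x)
    (hker : ∀ x ∈ S, (fderiv ℝ f x : E →ₗ[ℝ] F).ker = ⊥) (hinj : InjOn f S)
    (hS : MeasurableSet S) (g : F → G) :
    IntegrableOn g (f '' S) μHE[finrank ℝ E] ↔
      IntegrableOn (fun x => (fderiv ℝ f x : E →ₗ[ℝ] F).normDet • g (f x)) S := by
  have hcont : ContinuousOn f S := fun x hx => (hf x hx).continuousAt.continuousWithinAt
  have hemb := hcont.measurableEmbedding hS hinj
  rw [IntegrableOn, ← map_comap_withDensity_normDet_eq_euclideanHausdorffMeasure hf hker hinj hS,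
    hemb.integrable_map_iff]
  simp only [Set.domRestrict_eq, ← Function.comp_assoc, ENNReal.ofReal]
  rw [← (MeasurableEmbedding.subtype_coe hS).integrable_map_iff, map_comap_subtype_coe hS,
    restrict_withDensity hS, integrable_withDensity_iff_integrable_coe_smul₀]
  · simp_rw [IntegrableOn, Real.coe_toNNReal _ (LinearMap.normDet_nonneg _), Function.comp_apply]
  · exact aemeasurable_normDet_fderiv hf hS

/-- The area formula for Bochner integrals. -/
theorem setIntegral_image_eq_integral_normDet_smul
    {G : Type*} [NormedAddCommGroup G]
    [NormedSpace ℝ G] (hf : ∀ x ∈ S, ContDiffAt ℝ 1 f x)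
    (hker : ∀ x ∈ S, (fderiv ℝ f x : E →ₗ[ℝ] F).ker = ⊥) (hinj : InjOn f S)
    (hS : MeasurableSet S) (g : F → G) :
    ∫ y in f '' S, g y ∂μHE[finrank ℝ E] =
      ∫ x in S, (fderiv ℝ f x : E →ₗ[ℝ] F).normDet • g (f x) := by
  have hcont : ContinuousOn f S := fun x hx => (hf x hx).continuousAt.continuousWithinAt
  have hemb := hcont.measurableEmbedding hS hinj
  rw [← map_comap_withDensity_normDet_eq_euclideanHausdorffMeasure hf hker hinj hS,
    hemb.integral_map]
  simp only [Set.domRestrict_apply, ← Function.comp_apply (f := g), ENNReal.ofReal]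
  rw [← (MeasurableEmbedding.subtype_coe hS).integral_map, map_comap_subtype_coe hS,
    setIntegral_withDensity_eq_setIntegral_smul₀ (aemeasurable_normDet_fderiv hf hS) _ hS]
  congr with x
  rw [NNReal.smul_def, Real.coe_toNNReal _ (LinearMap.normDet_nonneg _)]

end AreaFormula

/-! ### Stokes' theorem on a rectangle -/

/-- Green's theorem on a rectangle for the one-form `⟪f, dw⟫`, whose differential is `df ∧ dw`, when
`f` vanishes on all sides except the left one. -/
theorem integral_inner_fderiv_wedge_eq_neg_integral_left {G : Type*} [NormedAddCommGroup G]
    [InnerProductSpace ℝ G] {f w : ℝ × ℝ → G} {a b : ℝ × ℝ} (hab : a ≤ b)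
    (hf : ∀ x ∈ Icc a b, ContDiffAt ℝ 1 f x) (hw : ∀ x ∈ Icc a b, ContDiffAt ℝ 2 w x)
    (hright : ∀ y ∈ Icc a.2 b.2, f (b.1, y) = 0) (hbot : ∀ x ∈ Icc a.1 b.1, f (x, a.2) = 0)
    (htop : ∀ x ∈ Icc a.1 b.1, f (x, b.2) = 0) :
    ∫ x in Icc a b, (⟪fderiv ℝ f x (1, 0), fderiv ℝ w x (0, 1)⟫_ℝ
        - ⟪fderiv ℝ f x (0, 1), fderiv ℝ w x (1, 0)⟫_ℝ)
      = -∫ y in a.2..b.2, ⟪f (a.1, y), fderiv ℝ w (a.1, y) (0, 1)⟫_ℝ := by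
  have hdw : ∀ v : ℝ × ℝ, ∀ x ∈ Icc a b, ContDiffAt ℝ 1 (fun x => fderiv ℝ w x v) x :=
    fun v x hx => ((hw x hx).fderiv_right (m := 1) (by norm_num)).clm_apply contDiffAt_const
  have hω : ∀ v : ℝ × ℝ, ∀ x ∈ Icc a b, ContDiffAt ℝ 1 (fun x => ⟪f x, fderiv ℝ w x v⟫_ℝ) x :=
    fun v x hx => (hf x hx).inner ℝ (hdw v x hx)
  have hderiv : ∀ v u : ℝ × ℝ, ∀ x ∈ Icc a b, fderiv ℝ (fun x => ⟪f x, fderiv ℝ w x v⟫_ℝ) x u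
      = ⟪f x, fderiv ℝ (fderiv ℝ w) x u v⟫_ℝ + ⟪fderiv ℝ f x u, fderiv ℝ w x v⟫_ℝ := by
    intro v u x hx
    have h1 : DifferentiableAt ℝ (fderiv ℝ w) x :=
      ((hw x hx).fderiv_right (m := 1) (by norm_num)).differentiableAt one_ne_zero
    rw [fderiv_inner_apply ℝ ((hf x hx).differentiableAt one_ne_zero)
      ((hdw v x hx).differentiableAt one_ne_zero)]
    rw [fderiv_clm_apply h1 (differentiableAt_const v)]
    simp
  have hsymm : ∀ x ∈ Icc a b, fderiv ℝ (fderiv ℝ w) x (1, 0) (0, 1)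
      = fderiv ℝ (fderiv ℝ w) x (0, 1) (1, 0) := fun x hx =>
    ((hw x hx).isSymmSndFDerivAt (by simp)) _ _
  set p : ℝ × ℝ → ℝ := fun x => ⟪f x, fderiv ℝ w x (0, 1)⟫_ℝ with hp
  set q : ℝ × ℝ → ℝ := fun x => -⟪f x, fderiv ℝ w x (1, 0)⟫_ℝ with hq
  have hpC : ∀ x ∈ Icc a b, ContDiffAt ℝ 1 p x := hω _
  have hqC : ∀ x ∈ Icc a b, ContDiffAt ℝ 1 q x := fun x hx => (hω _ x hx).neg
  have hsum : ∀ x ∈ Icc a b, fderiv ℝ p x (1, 0) + fderiv ℝ q x (0, 1)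
      = ⟪fderiv ℝ f x (1, 0), fderiv ℝ w x (0, 1)⟫_ℝ
        - ⟪fderiv ℝ f x (0, 1), fderiv ℝ w x (1, 0)⟫_ℝ := by
    intro x hx
    have hq' : fderiv ℝ q x = -fderiv ℝ (fun x => ⟪f x, fderiv ℝ w x (1, 0)⟫_ℝ) x := by
      rw [hq]; exact fderiv_neg
    rw [hq', hp, hderiv _ _ x hx, neg_apply, hderiv _ _ x hx, hsymm x hx]
    ring
  have hIoo : Ioo a.1 b.1 ×ˢ Ioo a.2 b.2 ⊆ Icc a b := by
    rw [Icc_prod_eq]; exact prod_mono Ioo_subset_Icc_self Ioo_subset_Icc_self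
  have hint : IntegrableOn (fun x => fderiv ℝ p x (1, 0) + fderiv ℝ q x (0, 1)) (Icc a b) := by
    refine ContinuousOn.integrableOn_compact isCompact_Icc fun x hx => ?_
    exact (((hpC x hx).continuousAt_fderiv one_ne_zero).clm_apply continuousAt_const
      |>.add (((hqC x hx).continuousAt_fderiv one_ne_zero).clm_apply
        continuousAt_const)).continuousWithinAt
  have key := integral_divergence_prod_Icc_of_hasFDerivAt_of_le p q (fderiv ℝ p) (fderiv ℝ q) a b
    hab (fun x hx => (hpC x hx).continuousAt.continuousWithinAt)
    (fun x hx => (hqC x hx).continuousAt.continuousWithinAt)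
    (fun x hx => ((hpC x (hIoo hx)).differentiableAt one_ne_zero).hasFDerivAt)
    (fun x hx => ((hqC x (hIoo hx)).differentiableAt one_ne_zero).hasFDerivAt) hint
  rw [setIntegral_congr_fun measurableSet_Icc hsum] at key
  rw [key]
  have h1 : ∫ x in a.1..b.1, q (x, b.2) = 0 := by
    refine (intervalIntegral.integral_congr fun x hx => ?_).trans intervalIntegral.integral_zero
    rw [uIcc_of_le hab.1] at hx
    simp [hq, htop x hx]
  have h2 : ∫ x in a.1..b.1, q (x, a.2) = 0 := by
    refine (intervalIntegral.integral_congr fun x hx => ?_).trans intervalIntegral.integral_zero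
    rw [uIcc_of_le hab.1] at hx
    simp [hq, hbot x hx]
  have h3 : ∫ y in a.2..b.2, p (b.1, y) = 0 := by
    refine (intervalIntegral.integral_congr fun x hx => ?_).trans intervalIntegral.integral_zero
    rw [uIcc_of_le hab.2] at hx
    simp [hp, hright x hx]
  rw [h1, h2, h3, sub_zero, zero_add, zero_sub]

/-! ### Vector algebra in three-space -/

theorem cross3_apply (u v : Euc3) :
    cross3 u v = !₂[u 1 * v 2 - u 2 * v 1, u 2 * v 0 - u 0 * v 2, u 0 * v 1 - u 1 * v 0] := by
  rw [cross3, cross_apply]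

theorem euc3_ext {u v : Euc3} (h0 : u 0 = v 0) (h1 : u 1 = v 1) (h2 : u 2 = v 2) : u = v := by
  ext i
  fin_cases i <;> assumption

theorem inner_euc3 (u v : Euc3) : ⟪u, v⟫_ℝ = u 0 * v 0 + u 1 * v 1 + u 2 * v 2 := by
  simp [PiLp.inner_apply, Fin.sum_univ_three, mul_comm]

theorem inner_self_cross3_left (u v : Euc3) : ⟪u, cross3 u v⟫_ℝ = 0 := by
  simp [inner_euc3, cross3_apply]; ring

theorem inner_self_cross3_right (u v : Euc3) : ⟪v, cross3 u v⟫_ℝ = 0 := by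
  simp [inner_euc3, cross3_apply]; ring

theorem norm_cross3_sq (u v : Euc3) : ‖cross3 u v‖ ^ 2 = ‖u‖ ^ 2 * ‖v‖ ^ 2 - ⟪u, v⟫_ℝ ^ 2 := by
  simp only [← real_inner_self_eq_norm_sq]
  simp only [inner_euc3]; simp [cross3_apply]; ring

theorem cross3_smul_left (c : ℝ) (u v : Euc3) : cross3 (c • u) v = c • cross3 u v := by
  simp [cross3]

theorem cross3_smul_right (c : ℝ) (u v : Euc3) : cross3 u (c • v) = c • cross3 u v := by
  simp [cross3]

theorem cross3_self (u : Euc3) : cross3 u u = 0 := by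
  simp [cross3]

theorem cross3_cross3 (u v : Euc3) :
    cross3 (cross3 u v) v = ⟪u, v⟫_ℝ • v - ⟪v, v⟫_ℝ • u := by
  simp only [inner_euc3]
  apply euc3_ext <;> simp [cross3_apply] <;> ring

/-- A vector orthogonal to `u` and `v` is parallel to `u × v`. -/
theorem norm_sq_smul_eq_inner_smul_of_orthogonal {n u v : Euc3} (hu : ⟪n, u⟫_ℝ = 0)
    (hv : ⟪n, v⟫_ℝ = 0) : ‖n‖ ^ 2 • cross3 u v = ⟪n, cross3 u v⟫_ℝ • n := by
  rw [← real_inner_self_eq_norm_sq]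
  simp only [inner_euc3] at hu hv ⊢
  apply euc3_ext <;> simp [cross3_apply]
  · linear_combination (n 1 * v 2 - n 2 * v 1) * hu + (n 2 * u 1 - n 1 * u 2) * hv
  · linear_combination (n 2 * v 0 - n 0 * v 2) * hu + (n 0 * u 2 - n 2 * u 0) * hv
  · linear_combination (n 0 * v 1 - n 1 * v 0) * hu + (n 1 * u 0 - n 0 * u 1) * hv

/-- The standard basis of three-space. -/
noncomputable def basis3 (i : Fin 3) : Euc3 := EuclideanSpace.single i 1

theorem sum_basis3 (v : Euc3) : v = v 0 • basis3 0 + v 1 • basis3 1 + v 2 • basis3 2 := by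
  apply euc3_ext <;> simp [basis3]

/-- For linear maps `A`, `B`, the vector representing the alternating form
`(u, v) ↦ ⟪A u, B v⟫ - ⟪A v, B u⟫` through the cross product. -/
noncomputable def wedgeVector (A B : Euc3 →L[ℝ] Euc3) : Euc3 :=
  !₂[⟪A (basis3 1), B (basis3 2)⟫_ℝ - ⟪A (basis3 2), B (basis3 1)⟫_ℝ,
    ⟪A (basis3 2), B (basis3 0)⟫_ℝ - ⟪A (basis3 0), B (basis3 2)⟫_ℝ,
    ⟪A (basis3 0), B (basis3 1)⟫_ℝ - ⟪A (basis3 1), B (basis3 0)⟫_ℝ]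

theorem inner_wedgeVector_cross3 (A B : Euc3 →L[ℝ] Euc3) (u v : Euc3) :
    ⟪wedgeVector A B, cross3 u v⟫_ℝ = ⟪A u, B v⟫_ℝ - ⟪A v, B u⟫_ℝ := by
  conv_rhs => rw [sum_basis3 u, sum_basis3 v]
  simp only [map_add, map_smul, inner_add_left, inner_add_right, inner_smul_left, inner_smul_right,
    inner_euc3, cross3_apply, wedgeVector]
  simp
  ring

/-! ### Tangent vectors in a flattening chart -/

/-- The velocity of the image under `f` of a ray staying in `f ⁻¹' s` is a positive tangent vector
of `s`. -/
theorem HasFDerivAt.mem_posTangentConeAt {E F : Type*} [NormedAddCommGroup E] [NormedSpace ℝ E]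
    [NormedAddCommGroup F] [NormedSpace ℝ F] {f : E → F} {f' : E →L[ℝ] F} {x v : E} {s : Set F}
    (hf : HasFDerivAt f f' x) (hs : ∀ᶠ h : ℝ in 𝓝[>] 0, f (x + h • v) ∈ s) :
    f' v ∈ posTangentConeAt s (f x) := by
  have hline : HasDerivAt (fun h : ℝ => f (x + h • v)) (f' v) 0 := by
    have h1 : HasDerivAt (fun h : ℝ => x + h • v) v 0 := by
      simpa using ((hasDerivAt_id (0 : ℝ)).smul_const v).const_add x
    have h2 : HasFDerivAt f f' (x + (0 : ℝ) • v) := by simpa using hf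
    exact h2.comp_hasDerivAt 0 h1
  have hslope := hline.tendsto_slope_zero_right
  simp only [zero_add, zero_smul, add_zero] at hslope
  refine mem_tangentConeAt_of_seq (𝓝[>] (0 : ℝ)) (fun h => (h⁻¹).toNNReal)
    (fun h => f (x + h • v) - f x) ?_ ?_ ?_
  · have := (hline.continuousAt.tendsto.mono_left (nhdsWithin_le_nhds (s := Ioi 0))).sub_const (f x)
    simpa using this
  · filter_upwards [hs] with h hh
    simpa using hh
  · refine hslope.congr' ?_
    filter_upwards [self_mem_nhdsWithin] with h hh
    rw [NNReal.smul_def, Real.coe_toNNReal _ (inv_nonneg.2 (le_of_lt hh))]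

/-- The inclusion of the coordinate plane `{x₂ = 0}`. -/
noncomputable def planeIncl : ℝ × ℝ →L[ℝ] Euc3 :=
  (ContinuousLinearMap.fst ℝ ℝ ℝ).smulRight (basis3 0)
    + (ContinuousLinearMap.snd ℝ ℝ ℝ).smulRight (basis3 1)

theorem planeIncl_apply (y : ℝ × ℝ) : planeIncl y = y.1 • basis3 0 + y.2 • basis3 1 := by
  simp [planeIncl]

@[simp] theorem planeIncl_zero (y : ℝ × ℝ) : planeIncl y 0 = y.1 := by
  simp [planeIncl_apply, basis3]

@[simp] theorem planeIncl_one (y : ℝ × ℝ) : planeIncl y 1 = y.2 := by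
  simp [planeIncl_apply, basis3]

@[simp] theorem planeIncl_two (y : ℝ × ℝ) : planeIncl y 2 = 0 := by
  simp [planeIncl_apply, basis3]

/-- The parametrization of the surface by the coordinate plane of a flattening chart. -/
noncomputable def chartPatch (Φ : OpenPartialHomeomorph Euc3 Euc3) (y : ℝ × ℝ) : Euc3 :=
  Φ.symm (planeIncl y)

/-- The coordinate vector fields of a chart. -/
noncomputable def chartFrame (Φ : OpenPartialHomeomorph Euc3 Euc3) (i : Fin 3) (x : Euc3) : Euc3 :=
  fderiv ℝ Φ.symm (Φ x) (basis3 i)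

theorem surfaceBoundary_subset (M : Set Euc3) : surfaceBoundary M ⊆ M := fun _ h => h.1

namespace IsFlatteningChart

variable {M : Set Euc3} {p : Euc3} {Φ : OpenPartialHomeomorph Euc3 Euc3}

theorem congr_center (hΦ : IsFlatteningChart M p Φ) {x : Euc3} (hx : x ∈ Φ.source) :
    IsFlatteningChart M x Φ :=
  ⟨hx, hΦ.smooth, hΦ.smooth_symm, hΦ.mem_iff⟩

theorem contDiffAt (hΦ : IsFlatteningChart M p Φ) {x : Euc3} (hx : x ∈ Φ.source) :
    ContDiffAt ℝ ∞ Φ x :=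
  hΦ.smooth.contDiffAt (Φ.open_source.mem_nhds hx)

theorem contDiffAt_symm (hΦ : IsFlatteningChart M p Φ) {z : Euc3} (hz : z ∈ Φ.target) :
    ContDiffAt ℝ ∞ Φ.symm z :=
  hΦ.smooth_symm.contDiffAt (Φ.open_target.mem_nhds hz)

theorem hasFDerivAt (hΦ : IsFlatteningChart M p Φ) {x : Euc3} (hx : x ∈ Φ.source) :
    HasFDerivAt Φ (fderiv ℝ Φ x) x :=
  ((hΦ.contDiffAt hx).differentiableAt (by simp)).hasFDerivAt

theorem hasFDerivAt_symm (hΦ : IsFlatteningChart M p Φ) {z : Euc3} (hz : z ∈ Φ.target) :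
    HasFDerivAt Φ.symm (fderiv ℝ Φ.symm z) z :=
  ((hΦ.contDiffAt_symm hz).differentiableAt (by simp)).hasFDerivAt

theorem fderiv_fderiv_symm (hΦ : IsFlatteningChart M p Φ) {x : Euc3} (hx : x ∈ Φ.source)
    (v : Euc3) : fderiv ℝ Φ x (fderiv ℝ Φ.symm (Φ x) v) = v := by
  have hz := Φ.map_source hx
  have h1 : HasFDerivAt Φ (fderiv ℝ Φ x) (Φ.symm (Φ x)) := by
    rw [Φ.left_inv hx]; exact hΦ.hasFDerivAt hx
  have h2 := h1.comp (Φ x) (hΦ.hasFDerivAt_symm hz)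
  have h3 : HasFDerivAt (Φ ∘ Φ.symm) (ContinuousLinearMap.id ℝ Euc3) (Φ x) := by
    refine (hasFDerivAt_id _).congr_of_eventuallyEq ?_
    filter_upwards [Φ.open_target.mem_nhds hz] with w hw
    exact Φ.right_inv hw
  exact congrArg (fun L : Euc3 →L[ℝ] Euc3 => L v) (h2.unique h3)

theorem fderiv_symm_fderiv (hΦ : IsFlatteningChart M p Φ) {x : Euc3} (hx : x ∈ Φ.source)
    (v : Euc3) : fderiv ℝ Φ.symm (Φ x) (fderiv ℝ Φ x v) = v := by
  have h2 := (hΦ.hasFDerivAt_symm (Φ.map_source hx)).comp x (hΦ.hasFDerivAt hx)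
  have h3 : HasFDerivAt (Φ.symm ∘ Φ) (ContinuousLinearMap.id ℝ Euc3) x := by
    refine (hasFDerivAt_id _).congr_of_eventuallyEq ?_
    filter_upwards [Φ.open_source.mem_nhds hx] with w hw
    exact Φ.left_inv hw
  exact congrArg (fun L : Euc3 →L[ℝ] Euc3 => L v) (h2.unique h3)

theorem fderiv_chartFrame (hΦ : IsFlatteningChart M p Φ) {x : Euc3} (hx : x ∈ Φ.source)
    (i : Fin 3) : fderiv ℝ Φ x (chartFrame Φ i x) = basis3 i :=
  hΦ.fderiv_fderiv_symm hx _

theorem eq_sum_chartFrame (hΦ : IsFlatteningChart M p Φ) {x : Euc3} (hx : x ∈ Φ.source)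
    (v : Euc3) : v = fderiv ℝ Φ x v 0 • chartFrame Φ 0 x + fderiv ℝ Φ x v 1 • chartFrame Φ 1 x
      + fderiv ℝ Φ x v 2 • chartFrame Φ 2 x := by
  conv_lhs => rw [← hΦ.fderiv_symm_fderiv hx v, sum_basis3 (fderiv ℝ Φ x v)]
  simp [chartFrame]

theorem chartFrame_contDiffOn (hΦ : IsFlatteningChart M p Φ) (i : Fin 3) :
    ContDiffOn ℝ ∞ (chartFrame Φ i) Φ.source := by
  intro x hx
  have h1 : ContDiffAt ℝ ∞ (fderiv ℝ Φ.symm) (Φ x) :=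
    (hΦ.contDiffAt_symm (Φ.map_source hx)).fderiv_right (by simp)
  exact ((h1.comp x (hΦ.contDiffAt hx)).clm_apply contDiffAt_const).contDiffWithinAt

theorem chartFrame_one_ne_zero (hΦ : IsFlatteningChart M p Φ) {x : Euc3} (hx : x ∈ Φ.source) :
    chartFrame Φ 1 x ≠ 0 := by
  intro h
  have := congrArg (fun v : Euc3 => v 1) (hΦ.fderiv_chartFrame hx 1)
  simp [h, basis3] at this

theorem cross3_chartFrame_ne_zero (hΦ : IsFlatteningChart M p Φ) {x : Euc3} (hx : x ∈ Φ.source) :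
    cross3 (chartFrame Φ 0 x) (chartFrame Φ 1 x) ≠ 0 := by
  intro h
  have h1 := cross3_cross3 (chartFrame Φ 0 x) (chartFrame Φ 1 x)
  rw [h, ← zero_smul ℝ (0 : Euc3), cross3_smul_left, zero_smul] at h1
  have h2 := congrArg (fun v : Euc3 => fderiv ℝ Φ x v 0) h1
  simp only [map_sub, map_smul, hΦ.fderiv_chartFrame hx] at h2
  simp [basis3] at h2
  exact hΦ.chartFrame_one_ne_zero hx h2

theorem eq_chartPatch (hΦ : IsFlatteningChart M p Φ) {x : Euc3} (hx : x ∈ Φ.source) (hxM : x ∈ M) :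
    planeIncl (Φ x 0, Φ x 1) = Φ x := by
  apply euc3_ext <;> simp [((hΦ.mem_iff x hx).1 hxM).1]

theorem chartPatch_mem_source {y : ℝ × ℝ} (hy : planeIncl y ∈ Φ.target) :
    chartPatch Φ y ∈ Φ.source := Φ.map_target hy

theorem apply_chartPatch {y : ℝ × ℝ} (hy : planeIncl y ∈ Φ.target) :
    Φ (chartPatch Φ y) = planeIncl y := Φ.right_inv hy

theorem chartPatch_mem_iff (hΦ : IsFlatteningChart M p Φ) {y : ℝ × ℝ}
    (hy : planeIncl y ∈ Φ.target) : chartPatch Φ y ∈ M ↔ 0 ≤ y.1 := by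
  rw [hΦ.mem_iff _ (chartPatch_mem_source hy), apply_chartPatch hy]
  simp

theorem contDiffAt_chartPatch (hΦ : IsFlatteningChart M p Φ) {y : ℝ × ℝ}
    (hy : planeIncl y ∈ Φ.target) : ContDiffAt ℝ ∞ (chartPatch Φ) y :=
  (hΦ.contDiffAt_symm hy).comp y planeIncl.contDiff.contDiffAt

theorem hasFDerivAt_chartPatch (hΦ : IsFlatteningChart M p Φ) {y : ℝ × ℝ}
    (hy : planeIncl y ∈ Φ.target) :
    HasFDerivAt (chartPatch Φ) (fderiv ℝ Φ.symm (planeIncl y) ∘L planeIncl) y :=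
  (hΦ.hasFDerivAt_symm hy).comp y planeIncl.hasFDerivAt

theorem fderiv_chartPatch_apply (hΦ : IsFlatteningChart M p Φ) {y : ℝ × ℝ}
    (hy : planeIncl y ∈ Φ.target) (v : ℝ × ℝ) : fderiv ℝ (chartPatch Φ) y v
      = v.1 • chartFrame Φ 0 (chartPatch Φ y) + v.2 • chartFrame Φ 1 (chartPatch Φ y) := by
  rw [(hΦ.hasFDerivAt_chartPatch hy).fderiv, chartFrame, chartFrame, apply_chartPatch hy]
  simp [planeIncl_apply]

/-- A tangent vector at a point of `M` pointing into the half-plane belongs to the tangent cone of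
every set which contains the corresponding piece of the patch. -/
theorem frame_mem_posTangentConeAt (hΦ : IsFlatteningChart M p Φ) {x : Euc3} (hx : x ∈ Φ.source)
    (hxM : x ∈ M) {s : Set Euc3} {c d : ℝ}
    (h : ∀ᶠ t : ℝ in 𝓝[>] 0, ∀ y : ℝ × ℝ, y = (Φ x 0 + t * c, Φ x 1 + t * d) →
      planeIncl y ∈ Φ.target → chartPatch Φ y ∈ s) :
    c • chartFrame Φ 0 x + d • chartFrame Φ 1 x ∈ posTangentConeAt s x := by
  have hy : planeIncl (Φ x 0, Φ x 1) ∈ Φ.target := by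
    rw [hΦ.eq_chartPatch hx hxM]; exact Φ.map_source hx
  have hyx : chartPatch Φ (Φ x 0, Φ x 1) = x := by
    rw [chartPatch, hΦ.eq_chartPatch hx hxM, Φ.left_inv hx]
  have hf := (hΦ.contDiffAt_chartPatch hy).differentiableAt (by simp) |>.hasFDerivAt
  have key := hf.mem_posTangentConeAt (v := (c, d)) (s := s) ?_
  · rw [hΦ.fderiv_chartPatch_apply hy, hyx] at key
    exact key
  · have hcont : Tendsto (fun t : ℝ => planeIncl ((Φ x 0, Φ x 1) + t • (c, d))) (𝓝[>] 0)
        (𝓝 (planeIncl (Φ x 0, Φ x 1))) := by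
      have : Continuous fun t : ℝ => planeIncl ((Φ x 0, Φ x 1) + t • (c, d)) := by fun_prop
      have h2 := (this.tendsto 0).mono_left (nhdsWithin_le_nhds (s := Ioi 0))
      simpa using h2
    filter_upwards [h, hcont.eventually (Φ.open_target.mem_nhds hy)] with t ht ht2
    exact ht _ (by simp) ht2

theorem frame_mem_posTangentConeAt_of_pos (hΦ : IsFlatteningChart M p Φ) {x : Euc3}
    (hx : x ∈ Φ.source) (hxM : x ∈ M) (h0 : 0 < Φ x 0) (c d : ℝ) :
    c • chartFrame Φ 0 x + d • chartFrame Φ 1 x ∈ posTangentConeAt M x := by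
  refine hΦ.frame_mem_posTangentConeAt hx hxM ?_
  have h1 : Tendsto (fun t : ℝ => Φ x 0 + t * c) (𝓝[>] 0) (𝓝 (Φ x 0 + 0 * c)) :=
    (Continuous.tendsto (by fun_prop) 0).mono_left nhdsWithin_le_nhds
  rw [zero_mul, add_zero] at h1
  filter_upwards [h1.eventually (lt_mem_nhds h0)] with t ht y hy hyt
  rw [hΦ.chartPatch_mem_iff hyt, hy]
  exact ht.le

theorem frame_mem_posTangentConeAt_of_nonneg (hΦ : IsFlatteningChart M p Φ) {x : Euc3}
    (hx : x ∈ Φ.source) (hxM : x ∈ M) {c : ℝ} (hc : 0 ≤ c) (d : ℝ) :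
    c • chartFrame Φ 0 x + d • chartFrame Φ 1 x ∈ posTangentConeAt M x := by
  refine hΦ.frame_mem_posTangentConeAt hx hxM ?_
  filter_upwards [self_mem_nhdsWithin] with t ht y hy hyt
  rw [hΦ.chartPatch_mem_iff hyt, hy]
  have := ((hΦ.mem_iff x hx).1 hxM).2
  have ht' : (0 : ℝ) < t := ht
  positivity

theorem hasFDerivAt_coord (hΦ : IsFlatteningChart M p Φ) {x : Euc3} (hx : x ∈ Φ.source)
    (i : Fin 3) : HasFDerivAt (fun z => Φ z i)
      ((EuclideanSpace.proj i : Euc3 →L[ℝ] ℝ) ∘L fderiv ℝ Φ x) x :=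
  ((EuclideanSpace.proj i : Euc3 →L[ℝ] ℝ).hasFDerivAt).comp x (hΦ.hasFDerivAt hx)

theorem fderiv_two_eq_zero (hΦ : IsFlatteningChart M p Φ) {x : Euc3} (hx : x ∈ Φ.source)
    (hxM : x ∈ M) {v : Euc3} (hv : v ∈ posTangentConeAt M x) : fderiv ℝ Φ x v 2 = 0 := by
  have hev : ∀ᶠ z in 𝓝[M] x, Φ z 2 = Φ x 2 := by
    filter_upwards [self_mem_nhdsWithin, mem_nhdsWithin_of_mem_nhds (Φ.open_source.mem_nhds hx)]
      with z hz hzs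
    rw [((hΦ.mem_iff z hzs).1 hz).1, ((hΦ.mem_iff x hx).1 hxM).1]
  refine le_antisymm ?_ ?_
  · exact IsLocalMaxOn.hasFDerivWithinAt_nonpos (hev.mono fun z hz => hz.le)
      (hΦ.hasFDerivAt_coord hx 2).hasFDerivWithinAt hv
  · exact IsLocalMinOn.hasFDerivWithinAt_nonneg (hev.mono fun z hz => hz.ge)
      (hΦ.hasFDerivAt_coord hx 2).hasFDerivWithinAt hv

theorem fderiv_zero_nonneg (hΦ : IsFlatteningChart M p Φ) {x : Euc3} (hx : x ∈ Φ.source)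
    (h0 : Φ x 0 = 0) {v : Euc3} (hv : v ∈ posTangentConeAt M x) : 0 ≤ fderiv ℝ Φ x v 0 := by
  refine IsLocalMinOn.hasFDerivWithinAt_nonneg (f := fun z => Φ z 0) ?_
    (hΦ.hasFDerivAt_coord hx 0).hasFDerivWithinAt hv
  filter_upwards [self_mem_nhdsWithin, mem_nhdsWithin_of_mem_nhds (Φ.open_source.mem_nhds hx)]
    with z hz hzs
  rw [h0]
  exact ((hΦ.mem_iff z hzs).1 hz).2

/-- Whether a point of `M` lies on the boundary can be read off in any chart: at a point with
`Φ x 0 > 0`, the tangent cone is a whole plane, which no half-plane contains. -/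
theorem mem_surfaceBoundary_iff (hΦ : IsFlatteningChart M p Φ) {x : Euc3} (hx : x ∈ Φ.source)
    (hxM : x ∈ M) : x ∈ surfaceBoundary M ↔ Φ x 0 = 0 := by
  refine ⟨?_, fun h => ⟨hxM, Φ, hΦ.congr_center hx, h⟩⟩
  rintro ⟨-, Ψ, hΨ, hΨ0⟩
  by_contra hne
  have hpos : 0 < Φ x 0 := lt_of_le_of_ne ((hΦ.mem_iff x hx).1 hxM).2 (Ne.symm hne)
  have hxΨ := hΨ.mem_source
  -- In the chart `Ψ`, both opposite vectors point into the half-plane, hence along its edge.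
  have hline : ∀ c d : ℝ, ∃ e : ℝ,
      c • chartFrame Φ 0 x + d • chartFrame Φ 1 x = e • chartFrame Ψ 1 x := by
    intro c d
    have hm1 := hΦ.frame_mem_posTangentConeAt_of_pos hx hxM hpos c d
    have hm2 := hΦ.frame_mem_posTangentConeAt_of_pos hx hxM hpos (-c) (-d)
    have e0 := hΨ.fderiv_zero_nonneg hxΨ hΨ0 hm1
    have e0' := hΨ.fderiv_zero_nonneg hxΨ hΨ0 hm2
    have e2 := hΨ.fderiv_two_eq_zero hxΨ hxM hm1
    have e0'' : fderiv ℝ Ψ x (c • chartFrame Φ 0 x + d • chartFrame Φ 1 x) 0 = 0 := by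
      have hneg : -c • chartFrame Φ 0 x + -d • chartFrame Φ 1 x
          = -(c • chartFrame Φ 0 x + d • chartFrame Φ 1 x) := by simp; abel
      rw [hneg, map_neg, PiLp.neg_apply] at e0'
      linarith
    refine ⟨fderiv ℝ Ψ x (c • chartFrame Φ 0 x + d • chartFrame Φ 1 x) 1,
      (hΨ.eq_sum_chartFrame hxΨ (c • chartFrame Φ 0 x + d • chartFrame Φ 1 x)).trans ?_⟩
    rw [e0'', e2]; simp
  obtain ⟨e, he⟩ := hline 1 0
  obtain ⟨e', he'⟩ := hline 0 1
  simp only [one_smul, zero_smul, add_zero, zero_add] at he he'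
  apply hΦ.cross3_chartFrame_ne_zero hx
  rw [he, he', cross3_smul_left, cross3_smul_right, cross3_self]
  simp

theorem chartPatch_mem_surfaceBoundary_iff (hΦ : IsFlatteningChart M p Φ) {y : ℝ × ℝ}
    (hy : planeIncl y ∈ Φ.target) : chartPatch Φ y ∈ surfaceBoundary M ↔ y.1 = 0 := by
  constructor
  · intro h
    have := (hΦ.mem_surfaceBoundary_iff (chartPatch_mem_source hy) h.1).1 h
    rwa [apply_chartPatch hy, planeIncl_zero] at this
  · intro h
    rw [hΦ.mem_surfaceBoundary_iff (chartPatch_mem_source hy)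
      ((hΦ.chartPatch_mem_iff hy).2 h.ge), apply_chartPatch hy, planeIncl_zero, h]

theorem smul_frame_one_mem_posTangentConeAt_boundary (hΦ : IsFlatteningChart M p Φ) {x : Euc3}
    (hx : x ∈ Φ.source) (hxB : x ∈ surfaceBoundary M) (d : ℝ) :
    d • chartFrame Φ 1 x ∈ posTangentConeAt (surfaceBoundary M) x := by
  have := hΦ.frame_mem_posTangentConeAt hx hxB.1 (s := surfaceBoundary M) (c := 0) (d := d) ?_
  · simpa using this
  · refine Eventually.of_forall fun t y hy hyt => ?_
    rw [hΦ.chartPatch_mem_surfaceBoundary_iff hyt, hy]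
    simp [(hΦ.mem_surfaceBoundary_iff hx hxB.1).1 hxB]

theorem eq_smul_of_mem_posTangentConeAt_boundary (hΦ : IsFlatteningChart M p Φ) {x : Euc3}
    (hx : x ∈ Φ.source) (hxB : x ∈ surfaceBoundary M) {v : Euc3}
    (hv : v ∈ posTangentConeAt (surfaceBoundary M) x) :
    v = fderiv ℝ Φ x v 1 • chartFrame Φ 1 x := by
  have h0 : Φ x 0 = 0 := (hΦ.mem_surfaceBoundary_iff hx hxB.1).1 hxB
  have hvM := posTangentConeAt_mono (surfaceBoundary_subset M) hv
  have e2 := hΦ.fderiv_two_eq_zero hx hxB.1 hvM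
  have e0 := hΦ.fderiv_zero_nonneg hx h0 hvM
  have e0' : fderiv ℝ Φ x v 0 ≤ 0 := by
    refine IsLocalMaxOn.hasFDerivWithinAt_nonpos (f := fun z => Φ z 0) ?_
      (hΦ.hasFDerivAt_coord hx 0).hasFDerivWithinAt hv
    filter_upwards [self_mem_nhdsWithin, mem_nhdsWithin_of_mem_nhds (Φ.open_source.mem_nhds hx)]
      with z hz hzs
    rw [h0, (hΦ.mem_surfaceBoundary_iff hzs hz.1).1 hz]
  refine (hΦ.eq_sum_chartFrame hx v).trans ?_
  rw [e2, le_antisymm e0' e0]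
  simp

/-! ### The unit normal and the boundary tangent in a flattening chart -/

variable {N : Euc3 → Euc3}

/-- The first two coordinate vectors are tangent to `M`, hence their cross product is normal. -/
theorem cross3_chartFrame_eq (hΦ : IsFlatteningChart M p Φ) (hN : IsUnitNormal M N) {x : Euc3}
    (hx : x ∈ Φ.source) (hxM : x ∈ M) : cross3 (chartFrame Φ 0 x) (chartFrame Φ 1 x)
      = ⟪N x, cross3 (chartFrame Φ 0 x) (chartFrame Φ 1 x)⟫_ℝ • N x := by
  have h0 := hN.inner_eq_zero x hxM _ (hΦ.frame_mem_posTangentConeAt_of_nonneg hx hxM zero_le_one 0)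
  have h1 := hN.inner_eq_zero x hxM _ (hΦ.frame_mem_posTangentConeAt_of_nonneg hx hxM le_rfl 1)
  simp only [one_smul, zero_smul, add_zero, zero_add] at h0 h1
  simpa [hN.norm_eq_one x hxM] using norm_sq_smul_eq_inner_smul_of_orthogonal h0 h1

/-- The boundary tangent is, up to normalization, the second coordinate vector, with the sign
opposite to the orientation of the chart. -/
theorem boundaryTangent_eq (hΦ : IsFlatteningChart M p Φ) {x : Euc3} (hx : x ∈ Φ.source)
    (hxB : x ∈ surfaceBoundary M) {s m : ℝ} (hs : s = 1 ∨ s = -1)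
    (hm : 0 < s * m) (hcross : cross3 (chartFrame Φ 0 x) (chartFrame Φ 1 x) = m • N x) :
    boundaryTangent M N x = -(s / ‖chartFrame Φ 1 x‖) • chartFrame Φ 1 x := by
  set a := chartFrame Φ 0 x with ha
  set b := chartFrame Φ 1 x with hb
  have hb0 : 0 < ‖b‖ := norm_pos_iff.2 (hΦ.chartFrame_one_ne_zero hx)
  have hm0 : m ≠ 0 := by rintro rfl; simp at hm
  have hss : s * s = 1 := by rcases hs with rfl | rfl <;> norm_num
  have hh0 : Φ x 0 = 0 := (hΦ.mem_surfaceBoundary_iff hx hxB.1).1 hxB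
  -- `N × b` has `a`-component `-‖b‖² / m`, so that `N × (c • b)` points into `M` iff `c * m ≤ 0`.
  have hcc : cross3 (N x) b = (⟪a, b⟫_ℝ / m) • b - (‖b‖ ^ 2 / m) • a := by
    have h1 := cross3_cross3 a b
    rw [hcross, cross3_smul_left, real_inner_self_eq_norm_sq] at h1
    have h2 := congrArg (fun v => m⁻¹ • v) h1
    simp only [smul_smul, inv_mul_cancel₀ hm0, one_smul, smul_sub] at h2
    rw [h2, div_eq_inv_mul, div_eq_inv_mul]
  have hαcross : ∀ c : ℝ, fderiv ℝ Φ x (cross3 (N x) (c • b)) 0 = -(c * (‖b‖ ^ 2 / m)) := by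
    intro c
    rw [cross3_smul_right, hcc]
    simp only [map_sub, map_smul, ha, hb, hΦ.fderiv_chartFrame hx]
    simp [basis3]
  have hex : ∃ T, IsPositiveBoundaryTangent M N x T := by
    refine ⟨-(s / ‖b‖) • b, ?_, hΦ.smul_frame_one_mem_posTangentConeAt_boundary hx hxB _, ?_⟩
    · rw [norm_smul, norm_neg, norm_div, norm_norm]
      have : ‖s‖ = 1 := by rcases hs with rfl | rfl <;> norm_num
      rw [this]; field_simp
    · have h1 : cross3 (N x) (-(s / ‖b‖) • b)
          = (s / ‖b‖ * (‖b‖ ^ 2 / m)) • a + (-(s / ‖b‖ * (⟪a, b⟫_ℝ / m))) • b := by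
        rw [cross3_smul_right, hcc]; module
      rw [h1]
      refine hΦ.frame_mem_posTangentConeAt_of_nonneg hx hxB.1 ?_ _
      have : s / ‖b‖ * (‖b‖ ^ 2 / m) = (s * m) * ‖b‖ / m ^ 2 := by field_simp
      rw [this]; positivity
  rw [boundaryTangent, dif_pos hex]
  obtain ⟨hT1, hT2, hT3⟩ := hex.choose_spec
  set T := hex.choose with hT
  have hTb := hΦ.eq_smul_of_mem_posTangentConeAt_boundary hx hxB hT2
  set c := fderiv ℝ Φ x T 1 with hc
  rw [hTb] at hT3
  have h3 := hΦ.fderiv_zero_nonneg hx hh0 hT3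
  rw [hαcross] at h3
  rw [hTb, norm_smul, Real.norm_eq_abs] at hT1
  have hcm : c * m ≤ 0 := by
    have h4 : c * m = c * (‖b‖ ^ 2 / m) * (m ^ 2 / ‖b‖ ^ 2) := by field_simp
    have h5 : 0 ≤ m ^ 2 / ‖b‖ ^ 2 := by positivity
    nlinarith
  -- The sign of `c` is opposite to that of `m`, which is the sign of `s`.
  have hcs : c * s ≤ 0 := by
    have h4 : (c * m) * (s * m) = (c * s) * m ^ 2 := by ring
    have h5 : 0 < m ^ 2 := by positivity
    by_contra hcon
    push Not at hcon
    nlinarith [mul_pos hcon h5]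
  have habs : |c| = -(c * s) := by
    rw [← abs_of_nonpos hcs, abs_mul]
    rcases hs with rfl | rfl <;> simp
  rw [hTb]
  congr 1
  rw [habs] at hT1
  field_simp
  linear_combination -s * hT1 - c * ‖b‖ * hss

end IsFlatteningChart

/-! ### Integrals over parametrized surfaces and curves in three-space -/

theorem normDet_eq_norm_cross3 (A : EuclideanSpace ℝ (Fin 2) →ₗ[ℝ] Euc3) :
    A.normDet = ‖cross3 (A (EuclideanSpace.single 0 1)) (A (EuclideanSpace.single 1 1))‖ := by
  rw [← sq_eq_sq₀ A.normDet_nonneg (norm_nonneg _), norm_cross3_sq]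
  have h := A.normDet_sq_eq_det_gram (EuclideanSpace.basisFun (Fin 2) ℝ)
  rw [RCLike.ofReal_real_eq_id] at h
  refine (show A.normDet ^ 2 = _ from h).trans ?_
  rw [Matrix.det_fin_two]
  simp only [Matrix.gram_apply, EuclideanSpace.basisFun_apply, real_inner_self_eq_norm_sq]
  rw [real_inner_comm (A (EuclideanSpace.single 0 1))]
  ring

theorem normDet_eq_norm_apply_one (A : ℝ →ₗ[ℝ] Euc3) : A.normDet = ‖A 1‖ := by
  rw [← sq_eq_sq₀ A.normDet_nonneg (norm_nonneg _)]
  have h := A.normDet_sq_eq_det_gram (OrthonormalBasis.singleton (Fin 1) ℝ)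
  rw [RCLike.ofReal_real_eq_id] at h
  refine (show A.normDet ^ 2 = _ from h).trans ?_
  simp [Matrix.gram_apply]

/-- The coordinates of the Euclidean plane, as a measurable equivalence with `ℝ × ℝ`. -/
noncomputable def euclideanPlaneEquiv : EuclideanSpace ℝ (Fin 2) ≃ᵐ ℝ × ℝ :=
  (MeasurableEquiv.toLp 2 (Fin 2 → ℝ)).symm.trans MeasurableEquiv.finTwoArrow

theorem euclideanPlaneEquiv_apply (z : EuclideanSpace ℝ (Fin 2)) :
    euclideanPlaneEquiv z = (z 0, z 1) := rfl

theorem measurePreserving_euclideanPlaneEquiv :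
    MeasurePreserving euclideanPlaneEquiv volume volume :=
  (volume_preserving_finTwoArrow ℝ).comp
    (EuclideanSpace.volume_preserving_symm_measurableEquiv_toLp (Fin 2))

section Surface

variable {ψ : ℝ × ℝ → Euc3} {S : Set (ℝ × ℝ)}

theorem fderiv_comp_euclideanPlaneEquiv {z : EuclideanSpace ℝ (Fin 2)}
    (h : ContDiffAt ℝ 1 ψ (euclideanPlaneEquiv z)) :
    ContDiffAt ℝ 1 (ψ ∘ euclideanPlaneEquiv) z ∧
    (fderiv ℝ (ψ ∘ euclideanPlaneEquiv) z : EuclideanSpace ℝ (Fin 2) →ₗ[ℝ] Euc3).normDet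
      = ‖cross3 (fderiv ℝ ψ (euclideanPlaneEquiv z) (1, 0))
          (fderiv ℝ ψ (euclideanPlaneEquiv z) (0, 1))‖ := by
  set e : EuclideanSpace ℝ (Fin 2) →L[ℝ] ℝ × ℝ :=
    (EuclideanSpace.proj 0 : EuclideanSpace ℝ (Fin 2) →L[ℝ] ℝ).prod
      (EuclideanSpace.proj 1 : EuclideanSpace ℝ (Fin 2) →L[ℝ] ℝ) with he
  have hfun : (euclideanPlaneEquiv : EuclideanSpace ℝ (Fin 2) → ℝ × ℝ) = e := by
    ext z <;> simp [euclideanPlaneEquiv_apply, he]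
  rw [hfun] at h ⊢
  refine ⟨h.comp z e.contDiff.contDiffAt, ?_⟩
  rw [normDet_eq_norm_cross3,
    ((h.differentiableAt one_ne_zero).hasFDerivAt.comp z e.hasFDerivAt).fderiv]
  simp [he]

/-- The area formula for surfaces parametrized by subsets of `ℝ × ℝ`, whose product norm is not
Euclidean: the measure-preserving identification with the Euclidean plane is used. -/
theorem integrableOn_and_setIntegral_image_surface (hS : MeasurableSet S) (hψ : ∀ y ∈ S, ContDiffAt ℝ 1 ψ y)
    (hinj : InjOn ψ S)
    (himm : ∀ y ∈ S, cross3 (fderiv ℝ ψ y (1, 0)) (fderiv ℝ ψ y (0, 1)) ≠ 0) (g : Euc3 → ℝ) :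
    (IntegrableOn g (ψ '' S) μHE[2] ↔ IntegrableOn (fun y =>
      ‖cross3 (fderiv ℝ ψ y (1, 0)) (fderiv ℝ ψ y (0, 1))‖ * g (ψ y)) S) ∧
    ∫ x in ψ '' S, g x ∂μHE[2] =
      ∫ y in S, ‖cross3 (fderiv ℝ ψ y (1, 0)) (fderiv ℝ ψ y (0, 1))‖ * g (ψ y) := by
  set f := ψ ∘ euclideanPlaneEquiv with hf
  set S' := euclideanPlaneEquiv ⁻¹' S with hS'
  have hS'm : MeasurableSet S' := euclideanPlaneEquiv.measurable hS
  have himg : f '' S' = ψ '' S := by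
    rw [hf, image_comp, hS', image_preimage_eq _ euclideanPlaneEquiv.surjective]
  have hfinj : InjOn f S' := fun x hx y hy h =>
    euclideanPlaneEquiv.injective (hinj hx hy h)
  have hd := fun z (hz : z ∈ S') => fderiv_comp_euclideanPlaneEquiv (hψ _ hz)
  have hker : ∀ z ∈ S', (fderiv ℝ f z : EuclideanSpace ℝ (Fin 2) →ₗ[ℝ] Euc3).ker = ⊥ := by
    intro z hz
    by_contra hne
    have := LinearMap.normDet_eq_zero_iff_ker_ne_bot.2 hne
    rw [(hd z hz).2, norm_eq_zero] at this
    exact himm _ hz this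
  have h1 := integrableOn_image_iff_integrableOn_normDet_smul (fun z hz => (hd z hz).1) hker hfinj
    hS'm g
  have h2 := setIntegral_image_eq_integral_normDet_smul (fun z hz => (hd z hz).1) hker hfinj
    hS'm g
  rw [himg, finrank_euclideanSpace_fin] at h1 h2
  constructor
  · rw [h1, ← measurePreserving_euclideanPlaneEquiv.integrableOn_comp_preimage
      euclideanPlaneEquiv.measurableEmbedding]
    refine integrableOn_congr_fun (fun z hz => ?_) hS'm
    simp only [smul_eq_mul]
    rw [(hd z hz).2]
    rfl
  · rw [h2, ← measurePreserving_euclideanPlaneEquiv.setIntegral_preimage_emb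
      euclideanPlaneEquiv.measurableEmbedding]
    refine setIntegral_congr_fun hS'm fun z hz => ?_
    simp only [smul_eq_mul]
    rw [(hd z hz).2]
    rfl

theorem integrableOn_image_surface_iff (hS : MeasurableSet S) (hψ : ∀ y ∈ S, ContDiffAt ℝ 1 ψ y)
    (hinj : InjOn ψ S)
    (himm : ∀ y ∈ S, cross3 (fderiv ℝ ψ y (1, 0)) (fderiv ℝ ψ y (0, 1)) ≠ 0) (g : Euc3 → ℝ) :
    IntegrableOn g (ψ '' S) μHE[2] ↔ IntegrableOn (fun y =>
      ‖cross3 (fderiv ℝ ψ y (1, 0)) (fderiv ℝ ψ y (0, 1))‖ * g (ψ y)) S :=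
  (integrableOn_and_setIntegral_image_surface hS hψ hinj himm g).1

theorem setIntegral_image_surface (hS : MeasurableSet S) (hψ : ∀ y ∈ S, ContDiffAt ℝ 1 ψ y)
    (hinj : InjOn ψ S)
    (himm : ∀ y ∈ S, cross3 (fderiv ℝ ψ y (1, 0)) (fderiv ℝ ψ y (0, 1)) ≠ 0) (g : Euc3 → ℝ) :
    ∫ x in ψ '' S, g x ∂μHE[2] =
      ∫ y in S, ‖cross3 (fderiv ℝ ψ y (1, 0)) (fderiv ℝ ψ y (0, 1))‖ * g (ψ y) :=
  (integrableOn_and_setIntegral_image_surface hS hψ hinj himm g).2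

end Surface

section Curve

variable {γ : ℝ → Euc3} {S : Set ℝ}

theorem ker_fderiv_eq_bot_of_ne_zero {t : ℝ} (h : fderiv ℝ γ t 1 ≠ 0) :
    (fderiv ℝ γ t : ℝ →ₗ[ℝ] Euc3).ker = ⊥ := by
  by_contra hne
  have := LinearMap.normDet_eq_zero_iff_ker_ne_bot.2 hne
  rw [normDet_eq_norm_apply_one, norm_eq_zero] at this
  exact h this

theorem integrableOn_image_curve_iff (hS : MeasurableSet S) (hγ : ∀ t ∈ S, ContDiffAt ℝ 1 γ t)
    (hinj : InjOn γ S) (himm : ∀ t ∈ S, fderiv ℝ γ t 1 ≠ 0) (g : Euc3 → ℝ) :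
    IntegrableOn g (γ '' S) μHE[1] ↔ IntegrableOn (fun t => ‖fderiv ℝ γ t 1‖ * g (γ t)) S := by
  have h1 := integrableOn_image_iff_integrableOn_normDet_smul hγ
    (fun t ht => ker_fderiv_eq_bot_of_ne_zero (himm t ht)) hinj hS g
  rw [finrank_self] at h1
  simpa only [normDet_eq_norm_apply_one, smul_eq_mul, ContinuousLinearMap.coe_coe] using h1

theorem setIntegral_image_curve (hS : MeasurableSet S) (hγ : ∀ t ∈ S, ContDiffAt ℝ 1 γ t)
    (hinj : InjOn γ S) (himm : ∀ t ∈ S, fderiv ℝ γ t 1 ≠ 0) (g : Euc3 → ℝ) :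
    ∫ x in γ '' S, g x ∂μHE[1] = ∫ t in S, ‖fderiv ℝ γ t 1‖ * g (γ t) := by
  have h1 := setIntegral_image_eq_integral_normDet_smul hγ
    (fun t ht => ker_fderiv_eq_bot_of_ne_zero (himm t ht)) hinj hS g
  rw [finrank_self] at h1
  simpa only [normDet_eq_norm_apply_one, smul_eq_mul, ContinuousLinearMap.coe_coe] using h1

end Curve

/-! ### Stokes' theorem in a coordinate box -/

theorem IsCompactSurface.isClosed_surfaceBoundary {M : Set Euc3} (hM : IsCompactSurface M) :
    IsClosed (surfaceBoundary M) := by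
  refine isClosed_of_closure_subset fun x hx => ?_
  have hxM : x ∈ M := hM.compact.isClosed.closure_subset_iff.2 (surfaceBoundary_subset M) hx
  obtain ⟨Φ, hΦ⟩ := hM.exists_chart x hxM
  rw [hΦ.mem_surfaceBoundary_iff hΦ.mem_source hxM]
  have hx' : x ∈ closure (surfaceBoundary M ∩ Φ.source) := by
    rw [inter_comm]
    exact Φ.open_source.inter_closure ⟨hΦ.mem_source, hx⟩
  have hcont : ContinuousAt (fun z => Φ z 0) x :=
    (hΦ.hasFDerivAt_coord hΦ.mem_source 0).continuousAt
  have hmaps : MapsTo (fun z => Φ z 0) (surfaceBoundary M ∩ Φ.source) {0} := fun z hz =>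
    (hΦ.mem_surfaceBoundary_iff hz.2 hz.1.1).1 hz.1
  have := hcont.continuousWithinAt.mem_closure hx' hmaps
  simpa using this

/-- The part of the source of `Φ` over an open square of the coordinate plane. -/
def chartBox (Φ : OpenPartialHomeomorph Euc3 Euc3) (q : ℝ × ℝ) (r : ℝ) : Set Euc3 :=
  {x | x ∈ Φ.source ∧ |Φ x 0 - q.1| < r ∧ |Φ x 1 - q.2| < r}

/-- The closed square of centre `q` and radius `r` lies in the range of the chart `Φ` of `M`, and
`s = ±1` tells whether the coordinates are positively oriented with respect to `N` on it. -/
structure IsOrientedBox (M : Set Euc3) (N : Euc3 → Euc3) (p : Euc3)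
    (Φ : OpenPartialHomeomorph Euc3 Euc3) (q : ℝ × ℝ) (r s : ℝ) : Prop where
  chart : IsFlatteningChart M p Φ
  pos : 0 < r
  nonneg : 0 ≤ q.1
  sign : s = 1 ∨ s = -1
  mem_target : ∀ y : ℝ × ℝ, |y.1 - q.1| ≤ r → |y.2 - q.2| ≤ r → planeIncl y ∈ Φ.target
  orient : ∀ y : ℝ × ℝ, |y.1 - q.1| ≤ r → |y.2 - q.2| ≤ r → 0 ≤ y.1 →
    0 < s * ⟪N (chartPatch Φ y),
      cross3 (chartFrame Φ 0 (chartPatch Φ y)) (chartFrame Φ 1 (chartPatch Φ y))⟫_ℝ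

theorem continuous_cross3 : Continuous fun v : Euc3 × Euc3 => cross3 v.1 v.2 := by
  simp only [cross3_apply]
  fun_prop

theorem contDiff_cross3 {n : WithTop ℕ∞} : ContDiff ℝ n fun v : Euc3 × Euc3 => cross3 v.1 v.2 := by
  have h0 : ∀ i, ContDiff ℝ n fun v : Euc3 × Euc3 => v.1 i := fun i =>
    (EuclideanSpace.proj i : Euc3 →L[ℝ] ℝ).contDiff.comp contDiff_fst
  have h1 : ∀ i, ContDiff ℝ n fun v : Euc3 × Euc3 => v.2 i := fun i =>
    (EuclideanSpace.proj i : Euc3 →L[ℝ] ℝ).contDiff.comp contDiff_snd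
  rw [contDiff_euclidean]
  intro i
  fin_cases i <;> simp only [cross3_apply]
  · exact ((h0 1).mul (h1 2)).sub ((h0 2).mul (h1 1))
  · exact ((h0 2).mul (h1 0)).sub ((h0 0).mul (h1 2))
  · exact ((h0 0).mul (h1 1)).sub ((h0 1).mul (h1 0))

/-- Every point of `M` has an oriented box around it: the sign of the chart with respect to `N` is
locally constant by continuity of `N`. -/
theorem IsCompactSurface.exists_isOrientedBox {M : Set Euc3} (hM : IsCompactSurface M)
    {N : Euc3 → Euc3} (hN : IsUnitNormal M N) {p : Euc3} (hp : p ∈ M) :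
    ∃ Φ q r s, IsOrientedBox M N p Φ q r s ∧ p ∈ chartBox Φ q r := by
  obtain ⟨Φ, hΦ⟩ := hM.exists_chart p hp
  have hps := hΦ.mem_source
  set n : Euc3 → Euc3 := fun x => cross3 (chartFrame Φ 0 x) (chartFrame Φ 1 x) with hn
  have hncont : ContinuousOn n Φ.source :=
    continuous_cross3.comp_continuousOn
      ((hΦ.chartFrame_contDiffOn 0).continuousOn.prodMk (hΦ.chartFrame_contDiffOn 1).continuousOn)
  set m : Euc3 → ℝ := fun x => ⟪N x, n x⟫_ℝ with hmdef
  have hmc : ContinuousWithinAt m M p :=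
    ContinuousWithinAt.inner (hN.continuousOn p hp)
      ((hncont.continuousAt (Φ.open_source.mem_nhds hps)).continuousWithinAt)
  have hm0 : m p ≠ 0 := by
    intro h0
    have := hΦ.cross3_chartFrame_eq hN hps hp
    rw [show ⟪N p, cross3 (chartFrame Φ 0 p) (chartFrame Φ 1 p)⟫_ℝ = 0 from h0, zero_smul] at this
    exact hΦ.cross3_chartFrame_ne_zero hps this
  obtain ⟨s, hs, hsm⟩ : ∃ s : ℝ, (s = 1 ∨ s = -1) ∧ 0 < s * m p := by
    rcases lt_or_gt_of_ne hm0 with h | h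
    · exact ⟨-1, Or.inr rfl, by linarith⟩
    · exact ⟨1, Or.inl rfl, by linarith⟩
  have hev : ∀ᶠ x in 𝓝[M] p, 0 < s * m x :=
    (continuousWithinAt_const.mul hmc).eventually (lt_mem_nhds hsm)
  obtain ⟨O, hO, hpO, hOM⟩ := mem_nhdsWithin.1 hev
  -- A small square around the coordinates of `p` is mapped into `Φ.target ∩ Φ.symm ⁻¹' O`.
  have hnhds : planeIncl ⁻¹' (Φ.target ∩ Φ.symm ⁻¹' O) ∈ 𝓝 (Φ p 0, Φ p 1) := by
    refine planeIncl.continuous.continuousAt.preimage_mem_nhds ?_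
    rw [hΦ.eq_chartPatch hps hp]
    refine (Φ.symm.isOpen_inter_preimage hO).mem_nhds ⟨Φ.map_source hps, ?_⟩
    simpa [Φ.left_inv hps] using hpO
  obtain ⟨r, hr, hball⟩ := Metric.nhds_basis_closedBall.mem_iff.1 hnhds
  have hmem : ∀ y : ℝ × ℝ, |y.1 - Φ p 0| ≤ r → |y.2 - Φ p 1| ≤ r →
      planeIncl y ∈ Φ.target ∧ Φ.symm (planeIncl y) ∈ O := by
    intro y h1 h2
    exact hball (by
      rw [Metric.mem_closedBall, Prod.dist_eq, Real.dist_eq, Real.dist_eq]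
      exact max_le h1 h2)
  refine ⟨Φ, (Φ p 0, Φ p 1), r, s, ⟨hΦ, hr, ((hΦ.mem_iff p hps).1 hp).2, hs,
    fun y h1 h2 => (hmem y h1 h2).1, fun y h1 h2 h3 => ?_⟩, hps, by simpa using hr,
    by simpa using hr⟩
  exact hOM ⟨(hmem y h1 h2).2, (hΦ.chartPatch_mem_iff (hmem y h1 h2).1).2 h3⟩

theorem isOpen_chartBox (Φ : OpenPartialHomeomorph Euc3 Euc3) (q : ℝ × ℝ) (r : ℝ) :
    IsOpen (chartBox Φ q r) := by
  have h0 : IsOpen {z : Euc3 | |z 0 - q.1| < r} := isOpen_lt (by fun_prop) continuous_const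
  have h1 : IsOpen {z : Euc3 | |z 1 - q.2| < r} := isOpen_lt (by fun_prop) continuous_const
  exact Φ.isOpen_inter_preimage (h0.inter h1)

namespace IsOrientedBox

variable {M : Set Euc3} {N : Euc3 → Euc3} {p : Euc3} {Φ : OpenPartialHomeomorph Euc3 Euc3}
  {q : ℝ × ℝ} {r s : ℝ}

/-- The parameters of the points of `M` in a coordinate box. -/
def surfaceParams (q : ℝ × ℝ) (r : ℝ) : Set (ℝ × ℝ) :=
  {y | 0 ≤ y.1 ∧ |y.1 - q.1| < r ∧ |y.2 - q.2| < r}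

/-- The parameters of the points of `∂M` in a coordinate box. -/
def boundaryParams (q : ℝ × ℝ) (r : ℝ) : Set ℝ :=
  {v | |0 - q.1| < r ∧ |v - q.2| < r}

/-- The closed rectangle of parameters with non-negative first coordinate. -/
def closedParams (q : ℝ × ℝ) (r : ℝ) : Set (ℝ × ℝ) :=
  Icc (max 0 (q.1 - r), q.2 - r) (q.1 + r, q.2 + r)

theorem mem_closedParams {y : ℝ × ℝ} : y ∈ closedParams q r ↔
    0 ≤ y.1 ∧ |y.1 - q.1| ≤ r ∧ |y.2 - q.2| ≤ r := by
  simp only [closedParams, mem_Icc, Prod.le_def, max_le_iff, abs_le]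
  constructor
  · rintro ⟨⟨⟨h1, h2⟩, h3⟩, h4, h5⟩
    exact ⟨h1, ⟨by linarith, by linarith⟩, by linarith, by linarith⟩
  · rintro ⟨h1, ⟨h2, h3⟩, h4, h5⟩
    exact ⟨⟨⟨h1, by linarith⟩, by linarith⟩, by linarith, by linarith⟩

theorem surfaceParams_subset : surfaceParams q r ⊆ closedParams q r := fun _ h =>
  mem_closedParams.2 ⟨h.1, h.2.1.le, h.2.2.le⟩

theorem measurableSet_closedParams : MeasurableSet (closedParams q r) := measurableSet_Icc

theorem measurableSet_surfaceParams : MeasurableSet (surfaceParams q r) := by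
  have h0 : IsOpen {y : ℝ × ℝ | |y.1 - q.1| < r} := isOpen_lt (by fun_prop) continuous_const
  have h1 : IsOpen {y : ℝ × ℝ | |y.2 - q.2| < r} := isOpen_lt (by fun_prop) continuous_const
  exact (measurableSet_le measurable_const measurable_fst).inter (h0.inter h1).measurableSet

theorem measurableSet_boundaryParams : MeasurableSet (boundaryParams q r) := by
  have h1 : IsOpen {v : ℝ | |v - q.2| < r} := isOpen_lt (by fun_prop) continuous_const
  exact (MeasurableSet.const _).inter h1.measurableSet

theorem zero_mem_surfaceParams {v : ℝ} (hv : v ∈ boundaryParams q r) :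
    ((0, v) : ℝ × ℝ) ∈ surfaceParams q r := ⟨le_rfl, hv.1, hv.2⟩

variable (h : IsOrientedBox M N p Φ q r s)
include h

theorem closedParams_mem_target {y : ℝ × ℝ} (hy : y ∈ closedParams q r) :
    planeIncl y ∈ Φ.target := by
  rw [mem_closedParams] at hy
  exact h.mem_target y hy.2.1 hy.2.2

theorem chartPatch_mem_chartBox_iff {y : ℝ × ℝ} (hy : y ∈ closedParams q r) :
    chartPatch Φ y ∈ chartBox Φ q r ↔ y ∈ surfaceParams q r := by
  have ht := h.closedParams_mem_target hy
  have hy' := mem_closedParams.1 hy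
  simp [chartBox, surfaceParams, IsFlatteningChart.apply_chartPatch ht,
    IsFlatteningChart.chartPatch_mem_source ht, hy'.1]

theorem inter_chartBox_eq : M ∩ chartBox Φ q r = chartPatch Φ '' surfaceParams q r := by
  ext x
  constructor
  · rintro ⟨hxM, hxs, hx0, hx1⟩
    refine ⟨(Φ x 0, Φ x 1), ⟨((h.chart.mem_iff x hxs).1 hxM).2, hx0, hx1⟩, ?_⟩
    rw [chartPatch, h.chart.eq_chartPatch hxs hxM, Φ.left_inv hxs]
  · rintro ⟨y, hy, rfl⟩
    have hyc := surfaceParams_subset hy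
    exact ⟨(h.chart.chartPatch_mem_iff (h.closedParams_mem_target hyc)).2 hy.1,
      (h.chartPatch_mem_chartBox_iff hyc).2 hy⟩

theorem boundary_inter_chartBox_eq : surfaceBoundary M ∩ chartBox Φ q r
    = (fun v => chartPatch Φ (0, v)) '' boundaryParams q r := by
  ext x
  constructor
  · rintro ⟨hxB, hxs, hx0, hx1⟩
    have h0 := (h.chart.mem_surfaceBoundary_iff hxs hxB.1).1 hxB
    rw [h0] at hx0
    refine ⟨Φ x 1, ⟨hx0, hx1⟩, ?_⟩
    have := h.chart.eq_chartPatch hxs hxB.1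
    rw [h0] at this
    simp only [chartPatch]
    rw [this, Φ.left_inv hxs]
  · rintro ⟨v, hv, rfl⟩
    have hy := zero_mem_surfaceParams hv
    have hyc := surfaceParams_subset hy
    exact ⟨(h.chart.chartPatch_mem_surfaceBoundary_iff (h.closedParams_mem_target hyc)).2 rfl,
      (h.chartPatch_mem_chartBox_iff hyc).2 hy⟩

theorem contDiffAt_chartPatch {y : ℝ × ℝ} (hy : y ∈ closedParams q r) {n : ℕ} :
    ContDiffAt ℝ n (chartPatch Φ) y :=
  (h.chart.contDiffAt_chartPatch (h.closedParams_mem_target hy)).of_le (by exact_mod_cast le_top)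

theorem fderiv_chartPatch {y : ℝ × ℝ} (hy : y ∈ closedParams q r) :
    fderiv ℝ (chartPatch Φ) y (1, 0) = chartFrame Φ 0 (chartPatch Φ y) ∧
    fderiv ℝ (chartPatch Φ) y (0, 1) = chartFrame Φ 1 (chartPatch Φ y) := by
  have ht := h.closedParams_mem_target hy
  constructor <;> rw [h.chart.fderiv_chartPatch_apply ht] <;> simp

theorem injOn_chartPatch : InjOn (chartPatch Φ) (closedParams q r) := by
  intro y hy z hz hyz
  have h1 := congrArg Φ hyz
  rw [IsFlatteningChart.apply_chartPatch (h.closedParams_mem_target hy),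
    IsFlatteningChart.apply_chartPatch (h.closedParams_mem_target hz)] at h1
  exact Prod.ext (by simpa using congrArg (fun v : Euc3 => v 0) h1)
    (by simpa using congrArg (fun v : Euc3 => v 1) h1)

theorem contDiffAt_boundaryPatch {v : ℝ} (hv : v ∈ boundaryParams q r) :
    ContDiffAt ℝ 1 (fun v : ℝ => chartPatch Φ (0, v)) v ∧
    fderiv ℝ (fun v : ℝ => chartPatch Φ (0, v)) v 1 = chartFrame Φ 1 (chartPatch Φ (0, v)) := by
  have hy := surfaceParams_subset (zero_mem_surfaceParams hv)
  have hC : ContDiffAt ℝ 1 (chartPatch Φ) ((fun v : ℝ => ((0, v) : ℝ × ℝ)) v) :=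
    h.contDiffAt_chartPatch (n := 1) hy
  have hl : HasFDerivAt (fun v : ℝ => ((0, v) : ℝ × ℝ)) (ContinuousLinearMap.inr ℝ ℝ ℝ) v :=
    (ContinuousLinearMap.inr ℝ ℝ ℝ).hasFDerivAt
  refine ⟨hC.comp v (contDiffAt_const.prodMk contDiffAt_id), ?_⟩
  have := ((hC.differentiableAt one_ne_zero).hasFDerivAt.comp v hl).fderiv
  rw [Function.comp_def] at this
  rw [this]
  simpa using (h.fderiv_chartPatch hy).2

theorem cross3_fderiv_ne_zero {y : ℝ × ℝ} (hy : y ∈ closedParams q r) :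
    cross3 (fderiv ℝ (chartPatch Φ) y (1, 0)) (fderiv ℝ (chartPatch Φ) y (0, 1)) ≠ 0 := by
  rw [(h.fderiv_chartPatch hy).1, (h.fderiv_chartPatch hy).2]
  exact h.chart.cross3_chartFrame_ne_zero
    (IsFlatteningChart.chartPatch_mem_source (h.closedParams_mem_target hy))

theorem setIntegral_surface (g : Euc3 → ℝ) : ∫ x in M ∩ chartBox Φ q r, g x ∂μHE[2] =
    ∫ y in surfaceParams q r, ‖cross3 (chartFrame Φ 0 (chartPatch Φ y))
      (chartFrame Φ 1 (chartPatch Φ y))‖ * g (chartPatch Φ y) := by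
  rw [h.inter_chartBox_eq, setIntegral_image_surface measurableSet_surfaceParams
    (fun y hy => h.contDiffAt_chartPatch (n := 1) (surfaceParams_subset hy))
    (h.injOn_chartPatch.mono surfaceParams_subset)
    (fun y hy => h.cross3_fderiv_ne_zero (surfaceParams_subset hy))]
  refine setIntegral_congr_fun measurableSet_surfaceParams fun y hy => ?_
  simp only [h.fderiv_chartPatch (surfaceParams_subset hy)]

theorem setIntegral_boundary (g : Euc3 → ℝ) :
    ∫ x in surfaceBoundary M ∩ chartBox Φ q r, g x ∂μHE[1] =
    ∫ v in boundaryParams q r, ‖chartFrame Φ 1 (chartPatch Φ (0, v))‖ * g (chartPatch Φ (0, v)) := by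
  have hinj : InjOn (fun v => chartPatch Φ (0, v)) (boundaryParams q r) := fun v hv w hw hvw =>
    congrArg Prod.snd (h.injOn_chartPatch (surfaceParams_subset (zero_mem_surfaceParams hv))
      (surfaceParams_subset (zero_mem_surfaceParams hw)) hvw)
  rw [h.boundary_inter_chartBox_eq, setIntegral_image_curve measurableSet_boundaryParams
    (fun v hv => (h.contDiffAt_boundaryPatch hv).1) hinj]
  · refine setIntegral_congr_fun measurableSet_boundaryParams fun v hv => ?_
    simp only [(h.contDiffAt_boundaryPatch hv).2]
  · intro v hv
    rw [(h.contDiffAt_boundaryPatch hv).2]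
    exact h.chart.chartFrame_one_ne_zero (IsFlatteningChart.chartPatch_mem_source
      (h.closedParams_mem_target (surfaceParams_subset (zero_mem_surfaceParams hv))))

theorem continuousOn_chartFrame_chartPatch (i : Fin 3) :
    ContinuousOn (fun y => chartFrame Φ i (chartPatch Φ y)) (closedParams q r) :=
  (h.chart.chartFrame_contDiffOn i).continuousOn.comp
    (fun _ hy => (h.contDiffAt_chartPatch (n := 0) hy).continuousAt.continuousWithinAt)
    (fun _ hy => IsFlatteningChart.chartPatch_mem_source (h.closedParams_mem_target hy))

theorem measure_surface_lt_top : μHE[2] (M ∩ chartBox Φ q r) < ⊤ := by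
  have h1 : IntegrableOn (fun _ => (1 : ℝ)) (M ∩ chartBox Φ q r) μHE[2] := by
    rw [h.inter_chartBox_eq, integrableOn_image_surface_iff measurableSet_surfaceParams
      (fun y hy => h.contDiffAt_chartPatch (n := 1) (surfaceParams_subset hy))
      (h.injOn_chartPatch.mono surfaceParams_subset)
      (fun y hy => h.cross3_fderiv_ne_zero (surfaceParams_subset hy))]
    have h2 : IntegrableOn (fun y => ‖cross3 (chartFrame Φ 0 (chartPatch Φ y))
        (chartFrame Φ 1 (chartPatch Φ y))‖) (closedParams q r) := by
      refine ContinuousOn.integrableOn_compact isCompact_Icc ?_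
      exact (continuous_cross3.comp_continuousOn ((h.continuousOn_chartFrame_chartPatch 0).prodMk
        (h.continuousOn_chartFrame_chartPatch 1))).norm
    refine (h2.mono_set surfaceParams_subset).congr_fun (fun y hy => ?_) measurableSet_surfaceParams
    simp [h.fderiv_chartPatch (surfaceParams_subset hy)]
  simpa [integrableOn_const_iff] using h1

theorem measure_boundary_lt_top : μHE[1] (surfaceBoundary M ∩ chartBox Φ q r) < ⊤ := by
  have hinj : InjOn (fun v => chartPatch Φ (0, v)) (boundaryParams q r) := fun v hv w hw hvw =>
    congrArg Prod.snd (h.injOn_chartPatch (surfaceParams_subset (zero_mem_surfaceParams hv))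
      (surfaceParams_subset (zero_mem_surfaceParams hw)) hvw)
  have h1 : IntegrableOn (fun _ => (1 : ℝ)) (surfaceBoundary M ∩ chartBox Φ q r) μHE[1] := by
    rw [h.boundary_inter_chartBox_eq, integrableOn_image_curve_iff measurableSet_boundaryParams
      (fun v hv => (h.contDiffAt_boundaryPatch hv).1) hinj]
    · by_cases hq : |0 - q.1| < r
      · have h2 : IntegrableOn (fun v => ‖chartFrame Φ 1 (chartPatch Φ (0, v))‖)
            (Icc (q.2 - r) (q.2 + r)) := by
          refine ContinuousOn.integrableOn_compact isCompact_Icc (ContinuousOn.norm ?_)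
          refine (h.continuousOn_chartFrame_chartPatch 1).comp
            (f := fun v : ℝ => ((0, v) : ℝ × ℝ)) (by fun_prop) fun v hv => ?_
          rw [mem_closedParams]
          exact ⟨le_rfl, hq.le, abs_le.2 ⟨by linarith [hv.1], by linarith [hv.2]⟩⟩
        have hsub : boundaryParams q r ⊆ Icc (q.2 - r) (q.2 + r) := fun v hv => by
          have := abs_lt.1 hv.2
          exact ⟨by linarith, by linarith⟩
        refine (h2.mono_set hsub).congr_fun (fun v hv => ?_) measurableSet_boundaryParams
        simp [(h.contDiffAt_boundaryPatch hv).2]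
      · have : boundaryParams q r = ∅ := eq_empty_of_forall_notMem fun v hv => hq hv.1
        rw [this]
        exact integrableOn_empty
    · intro v hv
      rw [(h.contDiffAt_boundaryPatch hv).2]
      exact h.chart.chartFrame_one_ne_zero (IsFlatteningChart.chartPatch_mem_source
        (h.closedParams_mem_target (surfaceParams_subset (zero_mem_surfaceParams hv))))
  simpa [integrableOn_const_iff] using h1

theorem orient_of_mem {x : Euc3} (hx : x ∈ M ∩ chartBox Φ q r) :
    0 < s * ⟪N x, cross3 (chartFrame Φ 0 x) (chartFrame Φ 1 x)⟫_ℝ := by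
  rw [h.inter_chartBox_eq] at hx
  obtain ⟨y, hy, rfl⟩ := hx
  exact h.orient y hy.2.1.le hy.2.2.le hy.1

theorem boundaryTangent_eq (hN : IsUnitNormal M N) {x : Euc3}
    (hx : x ∈ surfaceBoundary M ∩ chartBox Φ q r) :
    boundaryTangent M N x = -(s / ‖chartFrame Φ 1 x‖) • chartFrame Φ 1 x :=
  h.chart.boundaryTangent_eq hx.2.1 hx.1 h.sign (h.orient_of_mem ⟨hx.1.1, hx.2⟩)
    (h.chart.cross3_chartFrame_eq hN hx.2.1 hx.1.1)

theorem continuousOn_boundaryTangent (hN : IsUnitNormal M N) :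
    ContinuousOn (boundaryTangent M N) (surfaceBoundary M ∩ chartBox Φ q r) := by
  have hc : ContinuousOn (chartFrame Φ 1) (surfaceBoundary M ∩ chartBox Φ q r) :=
    (h.chart.chartFrame_contDiffOn 1).continuousOn.mono fun x hx => hx.2.1
  refine ContinuousOn.congr (f := fun x => -(s / ‖chartFrame Φ 1 x‖) • chartFrame Φ 1 x) ?_
    fun x hx => h.boundaryTangent_eq hN hx
  refine ((continuousOn_const.div hc.norm fun x hx => ?_).neg).smul hc
  exact norm_ne_zero_iff.2 (h.chart.chartFrame_one_ne_zero hx.2.1)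

/-- In an oriented box the unit normal is the restriction of a smooth field. -/
theorem exists_contDiffOn_eq_normal (hN : IsUnitNormal M N) :
    ∃ n : Euc3 → Euc3, ContDiffOn ℝ ∞ n (chartBox Φ q r) ∧
      ∀ x ∈ M ∩ chartBox Φ q r, n x = N x := by
  set c : Euc3 → Euc3 := fun x => cross3 (chartFrame Φ 0 x) (chartFrame Φ 1 x) with hc
  have hcs : ContDiffOn ℝ ∞ c (chartBox Φ q r) :=
    contDiff_cross3.comp_contDiffOn (((h.chart.chartFrame_contDiffOn 0).mono fun x hx => hx.1).prodMk
      ((h.chart.chartFrame_contDiffOn 1).mono fun x hx => hx.1))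
  have hc0 : ∀ x ∈ chartBox Φ q r, c x ≠ 0 := fun x hx => h.chart.cross3_chartFrame_ne_zero hx.1
  refine ⟨fun x => (s / ‖c x‖) • c x, ?_, fun x hx => ?_⟩
  · exact (contDiffOn_const.div (hcs.norm ℝ hc0) fun x hx => norm_ne_zero_iff.2 (hc0 x hx)).smul hcs
  · have h1 := h.chart.cross3_chartFrame_eq hN hx.2.1 hx.1
    have h2 := h.orient_of_mem hx
    set m := ⟪N x, cross3 (chartFrame Φ 0 x) (chartFrame Φ 1 x)⟫_ℝ
    have hn : ‖c x‖ = s * m := by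
      rw [hc]
      simp only
      rw [h1, norm_smul, hN.norm_eq_one x hx.1, mul_one, Real.norm_eq_abs, ← abs_of_pos h2, abs_mul]
      rcases h.sign with rfl | rfl <;> simp
    have hm : m ≠ 0 := by intro h0; rw [h0] at h2; simp at h2
    have hs0 : s ≠ 0 := by intro h0; rw [h0] at h2; simp at h2
    simp only
    rw [hn, show c x = m • N x from h1, smul_smul]
    have : s / (s * m) * m = 1 := by field_simp
    rw [this, one_smul]

/-- **Stokes' theorem** for the one-form `⟪V, dW⟫` on `M`, when `V` is supported in the box. In
coordinates it is Green's theorem, both sides being multiplied by the sign `s` of the chart. -/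
theorem stokes (hM : IsCompactSurface M) (hN : IsUnitNormal M N) {V W P Q : Euc3 → Euc3}
    (hPQ : ∀ x ∈ M, cross3 (P x) (Q x) = N x) (hV : ContDiff ℝ 1 V) (hW : ContDiff ℝ 2 W)
    (hsupp : tsupport V ⊆ chartBox Φ q r) :
    ∫ x in surfaceBoundary M, ⟪V x, fderiv ℝ W x (boundaryTangent M N x)⟫_ℝ ∂μHE[1]
      = ∫ x in M, (⟪fderiv ℝ V x (P x), fderiv ℝ W x (Q x)⟫_ℝ
          - ⟪fderiv ℝ V x (Q x), fderiv ℝ W x (P x)⟫_ℝ) ∂μHE[2] := by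
  have hV0 : ∀ x, x ∉ chartBox Φ q r → V x = 0 := fun x hx =>
    image_eq_zero_of_notMem_tsupport fun hx' => hx (hsupp hx')
  have hDV0 : ∀ x, x ∉ chartBox Φ q r → fderiv ℝ V x = 0 := fun x hx => by
    by_contra hne
    exact hx (hsupp (support_fderiv_subset ℝ hne))
  set ψ := chartPatch Φ with hψ
  set f := V ∘ ψ with hf
  set w := W ∘ ψ with hw
  have hfC : ∀ y ∈ closedParams q r, ContDiffAt ℝ 1 f y := fun y hy =>
    hV.contDiffAt.comp y (h.contDiffAt_chartPatch (n := 1) hy)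
  have hwC : ∀ y ∈ closedParams q r, ContDiffAt ℝ 2 w y := fun y hy =>
    hW.contDiffAt.comp y (h.contDiffAt_chartPatch (n := 2) hy)
  have hfd : ∀ y ∈ closedParams q r, ∀ u, fderiv ℝ f y u = fderiv ℝ V (ψ y) (fderiv ℝ ψ y u) := by
    intro y hy u
    rw [hf, fderiv_comp y (hV.differentiable one_ne_zero _)
      ((h.contDiffAt_chartPatch (n := 1) hy).differentiableAt one_ne_zero)]
    rfl
  have hwd : ∀ y ∈ closedParams q r, ∀ u, fderiv ℝ w y u = fderiv ℝ W (ψ y) (fderiv ℝ ψ y u) := by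
    intro y hy u
    rw [hw, fderiv_comp y (hW.differentiable two_ne_zero _)
      ((h.contDiffAt_chartPatch (n := 1) hy).differentiableAt one_ne_zero)]
    rfl
  have hf0 : ∀ y ∈ closedParams q r, y ∉ surfaceParams q r → f y = 0 := fun y hy hy' =>
    hV0 _ fun hmem => hy' ((h.chartPatch_mem_chartBox_iff hy).1 hmem)
  have hfd0 : ∀ y ∈ closedParams q r, y ∉ surfaceParams q r → ∀ u, fderiv ℝ f y u = 0 := by
    intro y hy hy' u
    rw [hfd y hy, hDV0 _ fun hmem => hy' ((h.chartPatch_mem_chartBox_iff hy).1 hmem), zero_apply]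
  -- The surface integral, in coordinates.
  set G : ℝ × ℝ → ℝ := fun y => ⟪fderiv ℝ f y (1, 0), fderiv ℝ w y (0, 1)⟫_ℝ
    - ⟪fderiv ℝ f y (0, 1), fderiv ℝ w y (1, 0)⟫_ℝ with hG
  have harea : ∫ x in M, (⟪fderiv ℝ V x (P x), fderiv ℝ W x (Q x)⟫_ℝ
      - ⟪fderiv ℝ V x (Q x), fderiv ℝ W x (P x)⟫_ℝ) ∂μHE[2]
      = s * ∫ y in closedParams q r, G y := by
    rw [setIntegral_eq_of_subset_of_forall_sdiff_eq_zero hM.compact.measurableSet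
      (inter_subset_left (t := chartBox Φ q r)) fun x hx => ?_, h.setIntegral_surface,
      ← integral_const_mul, setIntegral_eq_of_subset_of_forall_sdiff_eq_zero
        measurableSet_closedParams surfaceParams_subset fun y hy => ?_]
    · refine setIntegral_congr_fun measurableSet_surfaceParams fun y hy => ?_
      have hyc := surfaceParams_subset hy
      have hxM : ψ y ∈ M ∩ chartBox Φ q r := by
        rw [h.inter_chartBox_eq]; exact ⟨y, hy, rfl⟩
      simp only [hG]
      rw [hfd y hyc, hfd y hyc, hwd y hyc, hwd y hyc, (h.fderiv_chartPatch hyc).1,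
        (h.fderiv_chartPatch hyc).2, ← inner_wedgeVector_cross3, ← inner_wedgeVector_cross3,
        hPQ _ hxM.1]
      have h1 := h.chart.cross3_chartFrame_eq hN hxM.2.1 hxM.1
      have h2 := h.orient_of_mem hxM
      rw [← hψ]
      set m := ⟪N (ψ y), cross3 (chartFrame Φ 0 (ψ y)) (chartFrame Φ 1 (ψ y))⟫_ℝ
      rw [h1, norm_smul, hN.norm_eq_one _ hxM.1, mul_one, Real.norm_eq_abs, inner_smul_right,
        ← mul_assoc]
      congr 1
      rw [← abs_of_pos h2, abs_mul]
      rcases h.sign with rfl | rfl <;> simp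
    · simp only [hG, hfd0 y hy.1 hy.2, inner_zero_left, sub_zero, mul_zero]
    · rw [hDV0 x fun hx' => hx.2 ⟨hx.1, hx'⟩]
      simp
  -- The boundary integral, in coordinates.
  set H : ℝ × ℝ → ℝ := fun y => ⟪f y, fderiv ℝ w y (0, 1)⟫_ℝ with hH
  have hbd : ∫ x in surfaceBoundary M, ⟪V x, fderiv ℝ W x (boundaryTangent M N x)⟫_ℝ ∂μHE[1]
      = -s * ∫ v in boundaryParams q r, H (0, v) := by
    rw [setIntegral_eq_of_subset_of_forall_sdiff_eq_zero
      hM.isClosed_surfaceBoundary.measurableSet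
      (inter_subset_left (t := chartBox Φ q r)) fun x hx => ?_, h.setIntegral_boundary,
      ← integral_const_mul]
    · refine setIntegral_congr_fun measurableSet_boundaryParams fun v hv => ?_
      have hyc := surfaceParams_subset (zero_mem_surfaceParams hv)
      have hxB : ψ (0, v) ∈ surfaceBoundary M ∩ chartBox Φ q r := by
        rw [h.boundary_inter_chartBox_eq]; exact ⟨v, hv, rfl⟩
      simp only [hH]
      rw [hwd _ hyc, (h.fderiv_chartPatch hyc).2, ← hψ, h.boundaryTangent_eq hN hxB, map_smul,
        inner_smul_right, ← mul_assoc]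
      have hb0 := norm_ne_zero_iff.2 (h.chart.chartFrame_one_ne_zero hxB.2.1)
      have : ‖chartFrame Φ 1 (ψ (0, v))‖ * -(s / ‖chartFrame Φ 1 (ψ (0, v))‖) = -s := by
        field_simp
      rw [this]
      rfl
    · rw [hV0 x fun hx' => hx.2 ⟨hx.1, hx'⟩, inner_zero_left]
  -- If the rectangle does not reach the edge of the half-plane, both sides vanish.
  have hleft : ∫ v in boundaryParams q r, H (0, v)
      = ∫ v in (q.2 - r)..(q.2 + r), H (max 0 (q.1 - r), v) := by
    have hr := h.pos
    rw [intervalIntegral.integral_of_le (by linarith), integral_Ioc_eq_integral_Ioo]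
    rcases lt_or_ge (q.1 - r) 0 with hq | hq
    · have : boundaryParams q r = Ioo (q.2 - r) (q.2 + r) := by
        ext v
        have : |0 - q.1| < r := by rw [zero_sub, abs_neg, abs_of_nonneg h.nonneg]; linarith
        simp only [boundaryParams, mem_ofPred_eq, this, true_and, abs_lt, mem_Ioo]
        constructor <;> rintro ⟨h1, h2⟩ <;> constructor <;> linarith
      rw [this, max_eq_left hq.le]
    · have : boundaryParams q r = ∅ := by
        refine eq_empty_of_forall_notMem fun v hv => ?_
        have := hv.1
        rw [zero_sub, abs_neg, abs_of_nonneg h.nonneg] at this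
        linarith
      rw [this, setIntegral_empty, max_eq_right hq]
      refine (setIntegral_eq_zero_of_forall_eq_zero fun v hv => ?_).symm
      have hmem : ((q.1 - r, v) : ℝ × ℝ) ∈ closedParams q r := by
        rw [mem_closedParams]
        refine ⟨hq, ?_, abs_le.2 ⟨by linarith [hv.1], by linarith [hv.2]⟩⟩
        rw [show q.1 - r - q.1 = -r by ring, abs_neg, abs_of_pos hr]
      have : f (q.1 - r, v) = 0 := by
        refine hf0 _ hmem fun hc => ?_
        have := hc.2.1
        simp only [show q.1 - r - q.1 = -r by ring, abs_neg, abs_of_pos hr] at this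
        exact lt_irrefl _ this
      simp [hH, this]
  have hr := h.pos
  have hab : ((max 0 (q.1 - r), q.2 - r) : ℝ × ℝ) ≤ (q.1 + r, q.2 + r) :=
    ⟨max_le (by linarith [h.nonneg]) (by linarith), by simp only; linarith⟩
  have hgreen := integral_inner_fderiv_wedge_eq_neg_integral_left hab hfC hwC
    (fun v hv => hf0 _ ⟨⟨hab.1, hv.1⟩, le_rfl, hv.2⟩ fun hc => by
      have := hc.2.1
      simp [abs_of_pos hr] at this)
    (fun u hu => hf0 _ ⟨⟨hu.1, le_rfl⟩, hu.2, hab.2⟩ fun hc => by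
      have := hc.2.2
      simp [abs_of_pos hr] at this)
    (fun u hu => hf0 _ ⟨⟨hu.1, hab.2⟩, hu.2, le_rfl⟩ fun hc => by
      have := hc.2.2
      simp [abs_of_pos hr] at this)
  rw [hbd, harea, hleft, show ∫ y in closedParams q r, G y = _ from hgreen]
  ring

end IsOrientedBox

/-! ### Stokes' theorem on a compact surface -/

theorem ContinuousOn.integrableOn_isCompact_of_measure_lt_top {X : Type*} [TopologicalSpace X]
    [T2Space X] [MeasurableSpace X] [BorelSpace X] {μ : Measure X} {K : Set X} {f : X → ℝ}
    (hf : ContinuousOn f K) (hK : IsCompact K) (hμ : μ K < ⊤) : IntegrableOn f K μ := by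
  obtain ⟨C, hC⟩ := hK.exists_bound_of_continuousOn hf
  exact IntegrableOn.of_bound hμ (hf.aestronglyMeasurable_of_isCompact hK hK.measurableSet) C
    (ae_restrict_of_forall_mem hK.measurableSet hC)

namespace IsCompactSurface

variable {M : Set Euc3} {N : Euc3 → Euc3}

theorem isCompact_surfaceBoundary (hM : IsCompactSurface M) : IsCompact (surfaceBoundary M) :=
  hM.compact.of_isClosed_subset hM.isClosed_surfaceBoundary (surfaceBoundary_subset M)

theorem measure_lt_top (hM : IsCompactSurface M) (hN : IsUnitNormal M N) : μHE[2] M < ⊤ := by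
  refine hM.compact.measure_lt_top_of_nhdsWithin fun x hx => ?_
  obtain ⟨Φ, q, r, s, h, hxO⟩ := hM.exists_isOrientedBox hN hx
  refine ⟨M ∩ chartBox Φ q r, ?_, h.measure_surface_lt_top⟩
  exact inter_mem self_mem_nhdsWithin (mem_nhdsWithin_of_mem_nhds
    ((isOpen_chartBox Φ q r).mem_nhds hxO))

theorem measure_surfaceBoundary_lt_top (hM : IsCompactSurface M) (hN : IsUnitNormal M N) :
    μHE[1] (surfaceBoundary M) < ⊤ := by
  refine hM.isCompact_surfaceBoundary.measure_lt_top_of_nhdsWithin fun x hx => ?_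
  obtain ⟨Φ, q, r, s, h, hxO⟩ := hM.exists_isOrientedBox hN hx.1
  refine ⟨surfaceBoundary M ∩ chartBox Φ q r, ?_, h.measure_boundary_lt_top⟩
  exact inter_mem self_mem_nhdsWithin (mem_nhdsWithin_of_mem_nhds
    ((isOpen_chartBox Φ q r).mem_nhds hxO))

theorem continuousOn_boundaryTangent (hM : IsCompactSurface M) (hN : IsUnitNormal M N) :
    ContinuousOn (boundaryTangent M N) (surfaceBoundary M) := by
  intro x hx
  obtain ⟨Φ, q, r, s, h, hxO⟩ := hM.exists_isOrientedBox hN hx.1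
  exact (continuousWithinAt_inter ((isOpen_chartBox Φ q r).mem_nhds hxO)).1
    (h.continuousOn_boundaryTangent hN x ⟨hx, hxO⟩)

/-- The boundary tangent is a tangent vector of `∂M`. -/
theorem boundaryTangent_mem (hM : IsCompactSurface M) (hN : IsUnitNormal M N) {x : Euc3}
    (hx : x ∈ surfaceBoundary M) :
    boundaryTangent M N x ∈ posTangentConeAt (surfaceBoundary M) x := by
  obtain ⟨Φ, q, r, s, h, hxO⟩ := hM.exists_isOrientedBox hN hx.1
  rw [h.boundaryTangent_eq hN ⟨hx, hxO⟩]
  exact h.chart.smul_frame_one_mem_posTangentConeAt_boundary hxO.1 hx _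

/-- The unit normal is the restriction of a smooth vector field of three-space. -/
theorem exists_contDiff_eq_normal (hM : IsCompactSurface M) (hN : IsUnitNormal M N) :
    ∃ n : Euc3 → Euc3, ContDiff ℝ ∞ n ∧ ∀ x ∈ M, n x = N x := by
  classical
  have hconv : ∀ x, Convex ℝ {y | x ∈ M → y = N x} := fun x => by
    by_cases hx : x ∈ M
    · simp [hx]
    · simpa [hx] using convex_univ (𝕜 := ℝ)
  obtain ⟨g, hg⟩ := exists_contMDiffMap_forall_mem_convex_of_local (n := ⊤)
    (modelWithCornersSelf ℝ Euc3) hconv fun x => by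
      by_cases hx : x ∈ M
      · obtain ⟨Φ, q, r, s, h, hxO⟩ := hM.exists_isOrientedBox hN hx
        obtain ⟨n, hn, hnN⟩ := h.exists_contDiffOn_eq_normal hN
        exact ⟨chartBox Φ q r, (isOpen_chartBox Φ q r).mem_nhds hxO, n,
          contMDiffOn_iff_contDiffOn.2 hn, fun y hy hyM => hnN y ⟨hyM, hy⟩⟩
      · exact ⟨Mᶜ, hM.compact.isClosed.isOpen_compl.mem_nhds hx, fun _ => 0, contMDiffOn_const,
          fun y hy hyM => absurd hyM hy⟩
  exact ⟨g, contMDiff_iff_contDiff.1 g.contMDiff, hg⟩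

variable {V W P Q : Euc3 → Euc3}

theorem continuousOn_boundary_integrand (hM : IsCompactSurface M) (hN : IsUnitNormal M N)
    (hV : ContDiff ℝ 1 V) (hW : ContDiff ℝ 2 W) :
    ContinuousOn (fun x => ⟪V x, fderiv ℝ W x (boundaryTangent M N x)⟫_ℝ) (surfaceBoundary M) :=
  hV.continuous.continuousOn.inner
    ((hW.continuous_fderiv two_ne_zero).continuousOn.clm_apply (hM.continuousOn_boundaryTangent hN))

theorem integrableOn_boundary (hM : IsCompactSurface M) (hN : IsUnitNormal M N)
    (hV : ContDiff ℝ 1 V) (hW : ContDiff ℝ 2 W) :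
    IntegrableOn (fun x => ⟪V x, fderiv ℝ W x (boundaryTangent M N x)⟫_ℝ)
      (surfaceBoundary M) μHE[1] :=
  (hM.continuousOn_boundary_integrand hN hV hW).integrableOn_isCompact_of_measure_lt_top
    hM.isCompact_surfaceBoundary (hM.measure_surfaceBoundary_lt_top hN)

/-- The surface integrand is continuous although `P` and `Q` need not be, because it depends on them
through `N = P × Q` only. -/
theorem integrableOn_surface (hM : IsCompactSurface M) (hN : IsUnitNormal M N)
    (hPQ : ∀ x ∈ M, cross3 (P x) (Q x) = N x) (hV : ContDiff ℝ 1 V) (hW : ContDiff ℝ 2 W) :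
    IntegrableOn (fun x => ⟪fderiv ℝ V x (P x), fderiv ℝ W x (Q x)⟫_ℝ
      - ⟪fderiv ℝ V x (Q x), fderiv ℝ W x (P x)⟫_ℝ) M μHE[2] := by
  have hVd : Continuous (fderiv ℝ V) := hV.continuous_fderiv one_ne_zero
  have hWd : Continuous (fderiv ℝ W) := hW.continuous_fderiv two_ne_zero
  have hwedge : Continuous fun x => wedgeVector (fderiv ℝ V x) (fderiv ℝ W x) := by
    simp only [wedgeVector]
    fun_prop
  refine IntegrableOn.congr_fun (f := fun x =>
    ⟪wedgeVector (fderiv ℝ V x) (fderiv ℝ W x), N x⟫_ℝ) ?_ (fun x hx => ?_)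
    hM.compact.measurableSet
  · exact (hwedge.continuousOn.inner hN.continuousOn).integrableOn_isCompact_of_measure_lt_top
      hM.compact (hM.measure_lt_top hN)
  · simp only
    rw [← hPQ x hx, inner_wedgeVector_cross3]

/-- **Stokes' theorem** for the one-form `⟪V, dW⟫` on a compact oriented surface: its differential
takes the value `⟪dV(P), dW(Q)⟫ - ⟪dV(Q), dW(P)⟫` on tangent vectors with `P × Q = N`. -/
theorem stokes (hM : IsCompactSurface M) (hN : IsUnitNormal M N)
    (hPQ : ∀ x ∈ M, cross3 (P x) (Q x) = N x) (hV : ContDiff ℝ 1 V) (hW : ContDiff ℝ 2 W) :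
    ∫ x in surfaceBoundary M, ⟪V x, fderiv ℝ W x (boundaryTangent M N x)⟫_ℝ ∂μHE[1]
      = ∫ x in M, (⟪fderiv ℝ V x (P x), fderiv ℝ W x (Q x)⟫_ℝ
          - ⟪fderiv ℝ V x (Q x), fderiv ℝ W x (P x)⟫_ℝ) ∂μHE[2] := by
  classical
  have : Nonempty (OpenPartialHomeomorph Euc3 Euc3) := ⟨OpenPartialHomeomorph.refl Euc3⟩
  choose! Φ q r s hbox hmem using fun x hx => hM.exists_isOrientedBox hN (p := x) hx
  set O : Euc3 → Set Euc3 := fun x => chartBox (Φ x) (q x) (r x) with hO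
  have hOo : ∀ x, IsOpen (O x) := fun x => isOpen_chartBox _ _ _
  obtain ⟨t, htM, hcov⟩ := hM.compact.elim_nhds_subcover O
    fun x hx => (hOo x).mem_nhds (hmem x hx)
  -- The functions of the partition add up to one near `M`, so that no derivative of their sum
  -- contributes.
  obtain ⟨δ, hδ, hδO⟩ := hM.compact.exists_cthickening_subset_open
    (isOpen_biUnion fun x (_ : x ∈ t) => hOo x) hcov
  obtain ⟨f, hf⟩ := SmoothPartitionOfUnity.exists_isSubordinate (modelWithCornersSelf ℝ Euc3)
    (Metric.isClosed_cthickening (δ := δ) (E := M)) (fun i : t => O i) (fun i => hOo i)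
    (by rwa [biUnion_eq_iUnion] at hδO)
  have hfC : ∀ i : t, ContDiff ℝ 1 (f i) := fun i =>
    (contMDiff_iff_contDiff.1 (f i).contMDiff).of_le (by exact_mod_cast le_top)
  set Vi : t → Euc3 → Euc3 := fun i x => f i x • V x with hVi
  have hViC : ∀ i, ContDiff ℝ 1 (Vi i) := fun i => (hfC i).smul hV
  have hsupp : ∀ i, tsupport (Vi i) ⊆ O i := fun i =>
    (tsupport_smul_subset_left (f i) V).trans (hf i)
  have hsum : ∀ x ∈ Metric.cthickening δ M, ∑ i, Vi i x = V x := by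
    intro x hx
    have h1 := f.sum_eq_one hx
    rw [finsum_eq_sum_of_fintype] at h1
    rw [← Finset.sum_smul, h1, one_smul]
  have hsumM : ∀ x ∈ M, ∑ i, Vi i x = V x := fun x hx =>
    hsum x (Metric.self_subset_cthickening M hx)
  have hdsum : ∀ x ∈ M, fderiv ℝ V x = ∑ i, fderiv ℝ (Vi i) x := by
    intro x hx
    have hev : V =ᶠ[𝓝 x] fun x => ∑ i, Vi i x := by
      filter_upwards [Metric.isOpen_thickening.mem_nhds (Metric.self_subset_thickening hδ M hx)]
        with z hz
      exact (hsum z (Metric.thickening_subset_cthickening δ M hz)).symm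
    rw [hev.fderiv_eq, fderiv_fun_sum fun i _ => (hViC i).differentiable one_ne_zero x]
  have hlocal : ∀ i : t, _ := fun i =>
    (hbox i (htM i i.2)).stokes hM hN hPQ (hViC i) hW (hsupp i)
  calc _ = ∫ x in surfaceBoundary M,
        ∑ i, ⟪Vi i x, fderiv ℝ W x (boundaryTangent M N x)⟫_ℝ ∂μHE[1] := by
        refine setIntegral_congr_fun hM.isClosed_surfaceBoundary.measurableSet fun x hx => ?_
        rw [← sum_inner, hsumM x hx.1]
    _ = ∑ i, ∫ x in surfaceBoundary M,
        ⟪Vi i x, fderiv ℝ W x (boundaryTangent M N x)⟫_ℝ ∂μHE[1] :=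
        integral_finsetSum _ fun i _ => hM.integrableOn_boundary hN (hViC i) hW
    _ = ∑ i, ∫ x in M, (⟪fderiv ℝ (Vi i) x (P x), fderiv ℝ W x (Q x)⟫_ℝ
          - ⟪fderiv ℝ (Vi i) x (Q x), fderiv ℝ W x (P x)⟫_ℝ) ∂μHE[2] :=
        Finset.sum_congr rfl fun i _ => hlocal i
    _ = ∫ x in M, ∑ i, (⟪fderiv ℝ (Vi i) x (P x), fderiv ℝ W x (Q x)⟫_ℝ
          - ⟪fderiv ℝ (Vi i) x (Q x), fderiv ℝ W x (P x)⟫_ℝ) ∂μHE[2] :=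
        (integral_finsetSum _ fun i _ => hM.integrableOn_surface hN hPQ (hViC i) hW).symm
    _ = _ := by
        refine setIntegral_congr_fun hM.compact.measurableSet fun x hx => ?_
        rw [hdsum x hx, Finset.sum_sub_distrib, ← sum_inner, ← sum_inner, sum_apply, sum_apply]

/-! ### The differential of the Gauss map on tangent vectors -/

/-- Along vectors orthogonal to the normal, which are spanned by the tangent cone, any smooth
extension of the normal has the derivative of the Gauss map. -/
theorem fderivWithin_eq_of_inner_eq_zero (hM : IsCompactSurface M) (hN : IsUnitNormal M N)
    {n : Euc3 → Euc3} (hn : ContDiff ℝ ∞ n) (hnN : ∀ x ∈ M, n x = N x) {x v : Euc3} (hx : x ∈ M)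
    (hv : ⟪N x, v⟫_ℝ = 0) : fderivWithin ℝ N M x v = fderiv ℝ n x v := by
  obtain ⟨Φ, hΦ⟩ := hM.exists_chart x hx
  have hxs := hΦ.mem_source
  have h1 : HasFDerivWithinAt N (fderiv ℝ n x) M x :=
    ((hn.differentiable (by simp) x).hasFDerivAt.hasFDerivWithinAt).congr
      (fun y hy => (hnN y hy).symm) (hnN x hx).symm
  have h2 : EqOn (fderivWithin ℝ N M x) (fderiv ℝ n x) (tangentConeAt ℝ M x) :=
    h1.differentiableWithinAt.hasFDerivWithinAt.unique_on h1
  have hcone : ∀ u ∈ posTangentConeAt M x, u ∈ tangentConeAt ℝ M x := fun u hu =>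
    tangentConeAt_mono_field hu
  have ha := hΦ.frame_mem_posTangentConeAt_of_nonneg hxs hx zero_le_one 0
  have hb := hΦ.frame_mem_posTangentConeAt_of_nonneg hxs hx le_rfl 1
  simp only [one_smul, zero_smul, add_zero, zero_add] at ha hb
  -- The third coordinate vector is transversal to `M`, so that `v` has no component along it.
  have hc : ⟪N x, chartFrame Φ 2 x⟫_ℝ ≠ 0 := by
    intro h0
    have hall : ∀ u : Euc3, ⟪N x, u⟫_ℝ = 0 := by
      intro u
      rw [hΦ.eq_sum_chartFrame hxs u]
      simp [inner_add_right, inner_smul_right, hN.inner_eq_zero x hx _ ha,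
        hN.inner_eq_zero x hx _ hb, h0]
    have := hall (N x)
    rw [real_inner_self_eq_norm_sq, hN.norm_eq_one x hx] at this
    norm_num at this
  have hdec := hΦ.eq_sum_chartFrame hxs v
  have h20 : fderiv ℝ Φ x v 2 = 0 := by
    rw [hdec] at hv
    simp only [inner_add_right, inner_smul_right, hN.inner_eq_zero x hx _ ha,
      hN.inner_eq_zero x hx _ hb, mul_zero, zero_add] at hv
    exact (mul_eq_zero.1 hv).resolve_right hc
  rw [h20, zero_smul, add_zero] at hdec
  rw [hdec, map_add, map_add, map_smul, map_smul, map_smul, map_smul, h2 (hcone _ ha),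
    h2 (hcone _ hb)]

/-- The derivative along `∂M` in the direction of its tangent is that of any differentiable
extension. -/
theorem fderivWithin_boundaryTangent (hM : IsCompactSurface M) (hN : IsUnitNormal M N)
    {w W : Euc3 → Euc3} (hw : Differentiable ℝ w) (hwW : ∀ x ∈ M, w x = W x) {x : Euc3}
    (hx : x ∈ surfaceBoundary M) :
    fderivWithin ℝ W (surfaceBoundary M) x (boundaryTangent M N x)
      = fderiv ℝ w x (boundaryTangent M N x) := by
  have h1 : HasFDerivWithinAt W (fderiv ℝ w x) (surfaceBoundary M) x :=
    ((hw x).hasFDerivAt.hasFDerivWithinAt).congr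
      (fun y hy => (hwW y hy.1).symm) (hwW x hx.1).symm
  exact h1.differentiableWithinAt.hasFDerivWithinAt.unique_on h1
    (tangentConeAt_mono_field (hM.boundaryTangent_mem hN hx))

end IsCompactSurface

/-! ### The Hessian -/

theorem contDiff_gradient {F : Euc3 → ℝ} (hF : ContDiff ℝ 2 F) : ContDiff ℝ 1 (gradient F) :=
  (InnerProductSpace.toDual ℝ Euc3).symm.contDiff.comp (hF.fderiv_right (m := 1) (by norm_num))

theorem inner_hessian3 {F : Euc3 → ℝ} (hF : ContDiff ℝ 2 F) (x u v : Euc3) :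
    ⟪hessian3 F x u, v⟫_ℝ = fderiv ℝ (fderiv ℝ F) x u v := by
  have h1 : HasFDerivAt (fderiv ℝ F) (fderiv ℝ (fderiv ℝ F) x) x :=
    ((hF.fderiv_right (m := 1) (by norm_num)).differentiable one_ne_zero x).hasFDerivAt
  have h2 := ((InnerProductSpace.toDual ℝ Euc3).symm.toContinuousLinearEquiv.toContinuousLinearMap
    |>.hasFDerivAt (x := fderiv ℝ F x)).comp x h1
  have h3 : hessian3 F x = _ := h2.fderiv
  rw [h3]
  exact InnerProductSpace.toDual_symm_apply

theorem inner_hessian3_comm {F : Euc3 → ℝ} (hF : ContDiff ℝ 2 F) (x u v : Euc3) :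
    ⟪hessian3 F x u, v⟫_ℝ = ⟪hessian3 F x v, u⟫_ℝ := by
  rw [inner_hessian3 hF, inner_hessian3 hF]
  exact (hF.contDiffAt.isSymmSndFDerivAt (by simp)) u v

theorem mainTheorem6 (M : Set Euc3) (hM : IsCompactSurface M)
    (N : Euc3 → Euc3) (hN : IsUnitNormal M N)
    (P Q : Euc3 → Euc3) (κ₁ κ₂ : Euc3 → ℝ) (hPQ : IsPrincipalFrame M N P Q κ₁ κ₂)
    (F : Euc3 → ℝ) (hF : ContDiff ℝ 2 F) :
    (IntegrableOn (boundaryDensity M N (gradient F) N) (surfaceBoundary M) μHE[1] ∧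
      IntegrableOn (fun p => (κ₂ p - κ₁ p) * ⟪hessian3 F p (P p), Q p⟫_ℝ) M μHE[2] ∧
      boundaryIntegral M N (gradient F) N =
        -∫ p in M, (κ₂ p - κ₁ p) * ⟪hessian3 F p (P p), Q p⟫_ℝ ∂μHE[2]) ∧
    (IntegrableOn (boundaryDensity M N (fun p => gradient F (N p)) id)
        (surfaceBoundary M) μHE[1] ∧
      IntegrableOn (fun p => (κ₂ p - κ₁ p) * ⟪hessian3 F (N p) (P p), Q p⟫_ℝ) M μHE[2] ∧
      boundaryIntegral M N (fun p => gradient F (N p)) id =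
        ∫ p in M, (κ₂ p - κ₁ p) * ⟪hessian3 F (N p) (P p), Q p⟫_ℝ ∂μHE[2]) := by
  obtain ⟨n, hn, hnN⟩ := hM.exists_contDiff_eq_normal hN
  have hn2 : ContDiff ℝ 2 n := contDiff_infty.1 hn 2
  have hcross := hPQ.cross_eq
  have hMm := hM.compact.measurableSet
  have hBm := hM.isClosed_surfaceBoundary.measurableSet
  have hG := contDiff_gradient hF
  -- On tangent vectors, the smooth extension `n` of `N` has the derivative of the Gauss map.
  have hnP : ∀ x ∈ M, fderiv ℝ n x (P x) = -(κ₁ x • P x) := fun x hx => by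
    rw [← hPQ.deriv_left x hx, hM.fderivWithin_eq_of_inner_eq_zero hN hn hnN hx]
    rw [← hcross x hx, real_inner_comm, inner_self_cross3_left]
  have hnQ : ∀ x ∈ M, fderiv ℝ n x (Q x) = -(κ₂ x • Q x) := fun x hx => by
    rw [← hPQ.deriv_right x hx, hM.fderivWithin_eq_of_inner_eq_zero hN hn hnN hx]
    rw [← hcross x hx, real_inner_comm, inner_self_cross3_right]
  constructor
  · have hb : EqOn (fun x => ⟪gradient F x, fderiv ℝ n x (boundaryTangent M N x)⟫_ℝ)
        (boundaryDensity M N (gradient F) N) (surfaceBoundary M) := fun x hx => by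
      simp only [boundaryDensity]
      rw [hM.fderivWithin_boundaryTangent hN (hn2.differentiable two_ne_zero) hnN hx]
    have hs : EqOn (fun x => ⟪fderiv ℝ (gradient F) x (P x), fderiv ℝ n x (Q x)⟫_ℝ
        - ⟪fderiv ℝ (gradient F) x (Q x), fderiv ℝ n x (P x)⟫_ℝ)
        (fun x => -((κ₂ x - κ₁ x) * ⟪hessian3 F x (P x), Q x⟫_ℝ)) M := fun x hx => by
      simp only
      rw [hnP x hx, hnQ x hx]
      change ⟪hessian3 F x (P x), _⟫_ℝ - ⟪hessian3 F x (Q x), _⟫_ℝ = _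
      rw [inner_neg_right, inner_neg_right, inner_smul_right, inner_smul_right,
        inner_hessian3_comm hF x (Q x)]
      ring
    refine ⟨(hM.integrableOn_boundary hN hG hn2).congr_fun hb hBm, ?_, ?_⟩
    · simpa using ((hM.integrableOn_surface hN hcross hG hn2).congr_fun hs hMm).neg
    · rw [boundaryIntegral, ← setIntegral_congr_fun hBm hb, hM.stokes hN hcross hG hn2,
        setIntegral_congr_fun hMm hs, integral_neg]
  · have hV : ContDiff ℝ 1 (gradient F ∘ n) := hG.comp (hn2.of_le (by norm_num))
    have hid : ContDiff ℝ 2 (id : Euc3 → Euc3) := contDiff_id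
    have hb : EqOn (fun x => ⟪(gradient F ∘ n) x, fderiv ℝ id x (boundaryTangent M N x)⟫_ℝ)
        (boundaryDensity M N (fun p => gradient F (N p)) id) (surfaceBoundary M) := fun x hx => by
      simp only [boundaryDensity, Function.comp_apply]
      rw [hM.fderivWithin_boundaryTangent hN differentiable_id (fun _ _ => rfl) hx, hnN x hx.1]
    have hd : ∀ x ∈ M, ∀ u, fderiv ℝ (gradient F ∘ n) x u
        = hessian3 F (N x) (fderiv ℝ n x u) := fun x hx u => by
      rw [fderiv_comp x (hG.differentiable one_ne_zero _) (hn2.differentiable two_ne_zero _),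
        hnN x hx]
      rfl
    have hs : EqOn (fun x => ⟪fderiv ℝ (gradient F ∘ n) x (P x), fderiv ℝ id x (Q x)⟫_ℝ
        - ⟪fderiv ℝ (gradient F ∘ n) x (Q x), fderiv ℝ id x (P x)⟫_ℝ)
        (fun x => (κ₂ x - κ₁ x) * ⟪hessian3 F (N x) (P x), Q x⟫_ℝ) M := fun x hx => by
      simp only
      rw [hd x hx, hd x hx, hnP x hx, hnQ x hx, fderiv_id]
      simp only [map_neg, map_smul, inner_neg_left, inner_smul_left, ContinuousLinearMap.id_apply,
        inner_hessian3_comm hF (N x) (Q x), conj_trivial]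
      ring
    refine ⟨(hM.integrableOn_boundary hN hV hid).congr_fun hb hBm,
      (hM.integrableOn_surface hN hcross hV hid).congr_fun hs hMm, ?_⟩
    rw [boundaryIntegral, ← setIntegral_congr_fun hBm hb, hM.stokes hN hcross hV hid,
      setIntegral_congr_fun hMm hs]
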